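/- **Proposition (Performance of GREEDY).** *Setting.* Let $d,M\ge 1$, let $\Omega\subset\mathbb R^d$ be a closed non-degenerate reference simplex, and let $\overline\Gamma_0=\bigcup_{i=1}^M X_0^i(\Omega)\subset\mathbb R^{d+1}$ be a $d$-dimensional polyhedral surface whose (pairwise different) macro-elements $X_0^i(\Omega)$, with $X_0^i:\mathbb R^d\to\mathbb R^{d+1}$ injective and affine, form a conforming initial triangulation $\mathcal T_0$. (Of the surface property only this is used: two macro-elements that meet are joined by a chain of macro-elements that all contain their common face, consecutive ones sharing a $(d-1)$-face; this holds for all triangulated manifolds with or without boundary.) Simplices are tagged, $T=(x_0,\dots,x_d)_\gamma$ with type $\gamma\in\{0,\dots,d-1\}$, and the bisection of $T$ produces the two children $(x_0,\tfrac{x_0+x_d}2,x_1,\dots,x_{d-1})_{(\gamma+1)\bmod d}$ and $(x_d,\tfrac{x_0+x_d}2,x_1,\dots,x_\gamma,x_{d-1},\dots,x_{\gamma+1})_{(\gamma+1)\bmod d}$. The reflection of $T$ is $T_R=(x_d,x_1,\dots,x_\gamma,x_{d-1},\dots,x_{\gamma+1},x_0)_\gamma$; $T$ and $T'$ of the same type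 are reflected neighbours if the vertex sequence of $T$ or $T_R$ coincides with that of $T'$ at all but one position. Assume that $\mathcal T_0$ has an admissible labeling: its elements are tagged simplices of the same type, and for any two of them sharing a $(d-1)$-face $S$, if the refinement edge $x_0x_d$ of one of them lies in $S$, then they are reflected neighbours, and otherwise their children that contain $S$ are reflected neighbours. Let $\mathbb T$ be the set of all conforming meshes created by successive bisections of $\mathcal T_0$. For an element $T$ of $\mathcal T\in\mathbb T$ that descends from the $i$-th macro-element (we write $T\in\mathcal T^i$), let $\widehat T\subset\Omega$ be its preimage under $X_0^i$, and let $h_T:=|\widehat T|^{1/d}$. For $b\ge1$ and $\mathcal M\subset\mathcal T\in\mathbb T$, let $\mathsf{REFINE}(\mathcal T,\mathcal M)$ be the coarsest conforming refinement of $\mathcal T$ in which all elements of $\mathcal M$ have been bisected at least $b$ times. Given $\mathcal T\in\mathbb T$ and $\delta>0$, the module $\mathsf{GREEDY}(\mathbf g,\mathcal T,\delta)$ computes $\mathcal M:=\{T\in\mathcal T:\zeta_{\mathcal T}(\mathbf g,T)>\delta\}$, stops with output $\mathcal T$ if $\mathcal M=\emptyset$, and otherwise replaces $\mathcal T$ by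 $\mathsf{REFINE}(\mathcal T,\mathcal M)$ and repeats. *Statement.* Let $0<p\le\infty$, $r>0$ and $C_0>0$. There is a constant $C>0$, depending only on $d,M,\Omega,r,p,C_0$, such that the following holds for all such $\mathcal T_0$ with an admissible labeling and all $b\ge 1$. Let $\mathbf g=\{g^i\}_{i=1}^M:\Omega\to\mathbb R^M$, let $\zeta_{\mathcal T}(\mathbf g,T)\ge 0$ be local error estimators, and let $|g^i|_T,|\mathbf g|_\Omega\in[0,\infty]$ be quantities ($|g^i|_T$ depends on $g^i$ and the element only) with $$\zeta_{\mathcal T}(\mathbf g,T)\le C_0\,h_T^r\,|g^i|_T\quad (T\in\mathcal T^i,\ 1\le i\le M),\qquad \Big(\sum_{i=1}^M\sum_{T\in\mathcal T^i}|g^i|_T^p\Big)^{1/p}\le|\mathbf g|_\Omega$$ for all $\mathcal T\in\mathbb T$ (with $\max_i\max_{T\in\mathcal T^i}|g^i|_T\le|\mathbf g|_\Omega$ instead of the second bound if $p=\infty$). If $|\mathbf g|_\Omega<\infty$, then for every $\mathcal T\in\mathbb T$ and every $\delta>0$ the module $\mathsf{GREEDY}(\mathbf g,\mathcal T,\delta)$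 terminates in a finite number of steps, and the total number $\#\mathcal M$ of elements marked within it satisfies $$\#\mathcal M\le C\,|\mathbf g|_\Omega^{\frac{dp}{d+rp}}\,\delta^{-\frac{dp}{d+rp}},$$ where the exponent is read as $d/r$ if $p=\infty$. -/

import Mathlib

open scoped ENNReal

noncomputable section

namespace GreedyBisection

/-- The Euclidean space `ℝⁿ`. -/
abbrev E (n : ℕ) : Type := EuclideanSpace ℝ (Fin n)

/-! ### Tagged simplices and bisection -/

/-- A tagged `d`-simplex `(x₀, …, x_d)_γ`: an ordering of its vertices together with a type `γ`
(the relevant types are `0, …, d - 1`). Its refinement edge is `x₀ x_d`. -/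
structure TaggedSimplex (V : Type*) (d : ℕ) where
  vert : Fin (d + 1) → V
  type : ℕ

/-- The index map of the reflection
`(x₀, …, x_d)_γ ↦ (x_d, x₁, …, x_γ, x_{d-1}, …, x_{γ+1}, x₀)_γ`. -/
def reflectIdx (d γ : ℕ) (j : Fin (d + 1)) : Fin (d + 1) :=
  if j = 0 then Fin.last d
  else if j = Fin.last d then 0
  else if h : γ < j.val then ⟨d + γ - j.val, by omega⟩
  else j

namespace TaggedSimplex

variable {V W : Type*} {d : ℕ}

/-- The set of vertices. -/
def vertices (t : TaggedSimplex V d) : Set V := Set.range t.vert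

/-- The image under a map of the ambient spaces. -/
def map (f : V → W) (t : TaggedSimplex V d) : TaggedSimplex W d := ⟨f ∘ t.vert, t.type⟩

/-- The reflected tagged simplex
`(x_d, x₁, …, x_γ, x_{d-1}, …, x_{γ+1}, x₀)_γ`; it has the same two children. -/
def reflect (t : TaggedSimplex V d) : TaggedSimplex V d :=
  ⟨t.vert ∘ reflectIdx d t.type, t.type⟩

/-- The two vertices of the refinement edge `x₀ x_d`. -/
def refinementEdge (t : TaggedSimplex V d) : Set V := {t.vert 0, t.vert (Fin.last d)}

/-- `t` and `t'` have the same type, and the ordered sequence of vertices of `t` or of its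
reflection coincides with that of `t'` at all but one position. -/
def ReflectedNeighbours (t t' : TaggedSimplex V d) : Prop :=
  t.type = t'.type ∧
    ((∃! k, t.vert k ≠ t'.vert k) ∨ (∃! k, t.reflect.vert k ≠ t'.vert k))

variable [AddCommGroup V] [Module ℝ V]

/-- The closed simplex spanned by the vertices. -/
def region (t : TaggedSimplex V d) : Set V := convexHull ℝ t.vertices

/-- `(x₀, …, x_d)_γ ↦ (x₀, (x₀ + x_d) / 2, x₁, …, x_{d-1})_{(γ + 1) mod d}`. -/
def firstChild (t : TaggedSimplex V d) : TaggedSimplex V d where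
  vert := Fin.cons (t.vert 0) (fun k : Fin d =>
    if k.val = 0 then midpoint ℝ (t.vert 0) (t.vert (Fin.last d)) else t.vert k.castSucc)
  type := (t.type + 1) % d

/-- The two children of a tagged simplex, obtained by cutting it at the midpoint of the refinement
edge: `(x₀, (x₀ + x_d) / 2, x₁, …, x_{d-1})` and
`(x_d, (x₀ + x_d) / 2, x₁, …, x_γ, x_{d-1}, …, x_{γ+1})`, both of type `(γ + 1) mod d`. -/
def child (t : TaggedSimplex V d) (b : Bool) : TaggedSimplex V d :=
  if b then t.reflect.firstChild else t.firstChild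

/-- The matching condition for two neighbouring tagged simplices. If the refinement edge of one of
them lies in the common face, then they are reflected neighbours; otherwise the two children
that contain the common face are reflected neighbours. -/
def Match (t t' : TaggedSimplex V d) : Prop :=
  ((t.refinementEdge ⊆ t.vertices ∩ t'.vertices ∨
      t'.refinementEdge ⊆ t.vertices ∩ t'.vertices) → ReflectedNeighbours t t') ∧
  (¬ (t.refinementEdge ⊆ t.vertices ∩ t'.vertices ∨
      t'.refinementEdge ⊆ t.vertices ∩ t'.vertices) →
    ∀ b b' : Bool, t.vertices ∩ t'.vertices ⊆ (t.child b).vertices →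
      t.vertices ∩ t'.vertices ⊆ (t'.child b').vertices →
      ReflectedNeighbours (t.child b) (t'.child b'))

end TaggedSimplex

/-! ### The initial polyhedral surface and its labeling -/

/-- The reference simplex as a closed subset of `ℝᵈ`. -/
def refRegion {d : ℕ} (Ω : Affine.Simplex ℝ (E d) d) : Set (E d) :=
  convexHull ℝ (Set.range Ω.points)

/-- A `d`-dimensional polyhedral surface in `ℝᵈ⁺¹` that is the union of `M` macro-elements
`X₀ i (Ω)`, where `Ω` is the reference simplex and the `X₀ i` are injective affine maps.
The macro-elements are pairwise different and form a conforming triangulation. -/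
structure PolyhedralSurface (d M : ℕ) (Ω : Affine.Simplex ℝ (E d) d) where
  X₀ : Fin M → (E d →ᵃ[ℝ] E (d + 1))
  injective : ∀ i, Function.Injective (X₀ i)
  distinct : ∀ i j, i ≠ j → X₀ i '' Set.range Ω.points ≠ X₀ j '' Set.range Ω.points
  conforming : ∀ i j, X₀ i '' refRegion Ω ∩ X₀ j '' refRegion Ω ⊆
    convexHull ℝ (X₀ i '' Set.range Ω.points ∩ X₀ j '' Set.range Ω.points)
  /-- No pinching: two macro-elements that meet are joined by a chain of macro-elements which all
  contain their common face and in which consecutive ones share a `(d-1)`-dimensional face.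
  Every triangulated surface (manifold with or without boundary) has this property. -/
  chain : ∀ i j, (X₀ i '' Set.range Ω.points ∩ X₀ j '' Set.range Ω.points).Nonempty →
    Relation.ReflTransGen (fun k l : Fin M =>
      (X₀ k '' Set.range Ω.points ∩ X₀ l '' Set.range Ω.points).ncard = d ∧
      X₀ i '' Set.range Ω.points ∩ X₀ j '' Set.range Ω.points ⊆
        X₀ k '' Set.range Ω.points ∩ X₀ l '' Set.range Ω.points) i j

/-- A labeling of the initial triangulation: for each macro-element an ordering of the vertices
and a type in `{0, …, d - 1}`. -/
structure Labeling (d M : ℕ) where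
  order : Fin M → Equiv.Perm (Fin (d + 1))
  type : Fin M → ℕ
  type_lt : ∀ i, type i < d

/-! ### The bisection forest -/

/-- A node of the infinite binary forest: the index of the macro-element and the sequence of
choices of children, the most recent choice first. The nodes are the elements that can arise from
the macro-elements by successive bisections. -/
abbrev Elem (M : ℕ) : Type := Fin M × List Bool

/-- The child `b` of a node. -/
def Elem.child {M : ℕ} (T : Elem M) (b : Bool) : Elem M := (T.1, b :: T.2)

/-- The number of bisections that lead from the macro-element to the node. -/
def Elem.generation {M : ℕ} (T : Elem M) : ℕ := T.2.length

/-- `T'` arises from `T` by finitely many (possibly zero) bisections. -/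
def Elem.IsDescendant {M : ℕ} (T T' : Elem M) : Prop := T.1 = T'.1 ∧ T.2 <:+ T'.2

/-- The macro-elements. -/
def initialMesh (M : ℕ) : Finset (Elem M) := Finset.univ.image (fun i => (i, []))

/-- The meshes created by successive bisections of the initial mesh. -/
inductive IsBisectionMesh {M : ℕ} : Finset (Elem M) → Prop
  | init : IsBisectionMesh (initialMesh M)
  | bisect (𝒯 : Finset (Elem M)) (T : Elem M) : IsBisectionMesh 𝒯 → T ∈ 𝒯 →
      IsBisectionMesh (𝒯.erase T ∪ {T.child false, T.child true})

/-- `𝒯'` is a refinement of `𝒯`: every element of `𝒯'` arises from an element of `𝒯` by bisections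
(used for bisection meshes). -/
def Refines {M : ℕ} (𝒯' 𝒯 : Finset (Elem M)) : Prop :=
  ∀ T' ∈ 𝒯', ∃ T ∈ 𝒯, T.IsDescendant T'

/-- The tagged simplex in the parametric domain `Ω ⊆ ℝᵈ` that belongs to a node, given the index
of the macro-element and the sequence of choices of children. -/
def paramSimplex {d M : ℕ} (Ω : Affine.Simplex ℝ (E d) d) (L : Labeling d M) (i : Fin M) :
    List Bool → TaggedSimplex (E d) d
  | [] => ⟨Ω.points ∘ L.order i, L.type i⟩
  | b :: w => (paramSimplex Ω L i w).child b

/-- The corresponding tagged simplex on the polyhedral surface. -/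
def surfSimplex {d M : ℕ} {Ω : Affine.Simplex ℝ (E d) d} (K : PolyhedralSurface d M Ω)
    (L : Labeling d M) (T : Elem M) : TaggedSimplex (E (d + 1)) d :=
  (paramSimplex Ω L T.1 T.2).map (K.X₀ T.1)

/-- The mesh size `h_T = |T̂|^{1/d}`, with `T̂` the element in the parametric domain. -/
def meshSize {d M : ℕ} (Ω : Affine.Simplex ℝ (E d) d) (L : Labeling d M) (T : Elem M) : ℝ :=
  (MeasureTheory.volume.real (paramSimplex Ω L T.1 T.2).region) ^ (1 / d : ℝ)

/-- The labeling of the initial triangulation is admissible: all macro-elements have the same type,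
and any two macro-elements that share a `(d-1)`-dimensional face match. -/
def IsAdmissible {d M : ℕ} {Ω : Affine.Simplex ℝ (E d) d} (K : PolyhedralSurface d M Ω)
    (L : Labeling d M) : Prop :=
  (∀ i j, L.type i = L.type j) ∧
  ∀ i j, i ≠ j →
    ((surfSimplex K L (i, [])).vertices ∩ (surfSimplex K L (j, [])).vertices).ncard = d →
    (surfSimplex K L (i, [])).Match (surfSimplex K L (j, []))

/-- A mesh is conforming if, on the polyhedral surface, any two of its elements meet exactly in the
simplex spanned by their common vertices (which is empty if there are none). -/
def IsConforming {d M : ℕ} {Ω : Affine.Simplex ℝ (E d) d} (K : PolyhedralSurface d M Ω)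
    (L : Labeling d M) (𝒯 : Finset (Elem M)) : Prop :=
  ∀ T ∈ 𝒯, ∀ T' ∈ 𝒯, (surfSimplex K L T).region ∩ (surfSimplex K L T').region =
    convexHull ℝ ((surfSimplex K L T).vertices ∩ (surfSimplex K L T').vertices)

/-- The forest `𝕋`: all conforming meshes created by successive bisections of the initial mesh. -/
def forest {d M : ℕ} {Ω : Affine.Simplex ℝ (E d) d} (K : PolyhedralSurface d M Ω)
    (L : Labeling d M) : Set (Finset (Elem M)) :=
  {𝒯 | IsBisectionMesh 𝒯 ∧ IsConforming K L 𝒯}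

/-! ### The modules REFINE and GREEDY -/

/-- The conforming refinements of `𝒯` in which all elements of `𝓜` have been bisected at least
`b` times. -/
def refinements {d M : ℕ} {Ω : Affine.Simplex ℝ (E d) d} (K : PolyhedralSurface d M Ω)
    (L : Labeling d M) (b : ℕ) (𝒯 𝓜 : Finset (Elem M)) : Set (Finset (Elem M)) :=
  {𝒯' | 𝒯' ∈ forest K L ∧ Refines 𝒯' 𝒯 ∧
    ∀ T ∈ 𝓜, ∀ T' ∈ 𝒯', T.IsDescendant T' → T.generation + b ≤ T'.generation}

/-- `𝒯' = REFINE(𝒯, 𝓜)`: all elements of `𝓜` are bisected at least `b` times, and only those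
additional bisections are made that are necessary for conformity, so that `𝒯'` is the coarsest
of all conforming refinements of this kind. -/
def IsREFINE {d M : ℕ} {Ω : Affine.Simplex ℝ (E d) d} (K : PolyhedralSurface d M Ω)
    (L : Labeling d M) (b : ℕ) (𝒯 𝓜 𝒯' : Finset (Elem M)) : Prop :=
  𝒯' ∈ refinements K L b 𝒯 𝓜 ∧ ∀ 𝒰 ∈ refinements K L b 𝒯 𝓜, Refines 𝒰 𝒯'

/-- The marked elements: those with local error estimator above the tolerance `δ`. -/
def marked {M : ℕ} (ζ : Finset (Elem M) → Elem M → ℝ≥0∞) (δ : ℝ) (𝒯 : Finset (Elem M)) :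
    Finset (Elem M) :=
  {T ∈ 𝒯 | ENNReal.ofReal δ < ζ 𝒯 T}

/-- One pass of the loop of `GREEDY`: the set of marked elements is not empty, and the mesh is
replaced by its refinement. -/
def GreedyStep {d M : ℕ} {Ω : Affine.Simplex ℝ (E d) d} (K : PolyhedralSurface d M Ω)
    (L : Labeling d M) (b : ℕ) (ζ : Finset (Elem M) → Elem M → ℝ≥0∞) (δ : ℝ)
    (𝒯 𝒯' : Finset (Elem M)) : Prop :=
  marked ζ δ 𝒯 ≠ ∅ ∧ IsREFINE K L b 𝒯 (marked ζ δ 𝒯) 𝒯'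

/-- `GreedyRun K L b ζ δ 𝒯 𝒯' N`: the module `GREEDY`, started from the mesh `𝒯`, stops after
finitely many passes with output `𝒯'`, and marks `N` elements in total. -/
inductive GreedyRun {d M : ℕ} {Ω : Affine.Simplex ℝ (E d) d} (K : PolyhedralSurface d M Ω)
    (L : Labeling d M) (b : ℕ) (ζ : Finset (Elem M) → Elem M → ℝ≥0∞) (δ : ℝ) :
    Finset (Elem M) → Finset (Elem M) → ℕ → Prop
  | exit (𝒯 : Finset (Elem M)) : marked ζ δ 𝒯 = ∅ → GreedyRun K L b ζ δ 𝒯 𝒯 0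
  | step (𝒯 𝒯₁ 𝒯' : Finset (Elem M)) (N : ℕ) : GreedyStep K L b ζ δ 𝒯 𝒯₁ →
      GreedyRun K L b ζ δ 𝒯₁ 𝒯' N →
      GreedyRun K L b ζ δ 𝒯 𝒯' ((marked ζ δ 𝒯).card + N)

/-! ### Accumulation of local quantities and the exponent -/

/-- The `ℓ_p` accumulation `(∑_{T ∈ 𝒯} a_T ^ p)^{1/p}` for `0 < p < ∞`, and `max_{T ∈ 𝒯} a_T`
for `p = ∞`. -/
def lpAccum {M : ℕ} (p : ℝ≥0∞) (𝒯 : Finset (Elem M)) (a : Elem M → ℝ≥0∞) : ℝ≥0∞ :=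
  if p = ∞ then 𝒯.sup a else (∑ T ∈ 𝒯, a T ^ p.toReal) ^ (1 / p.toReal)

/-- The exponent `d p / (d + r p)`, which is `d / r` for `p = ∞`. -/
def greedyExponent (d : ℕ) (r : ℝ) (p : ℝ≥0∞) : ℝ :=
  if p = ∞ then d / r else d * p.toReal / (d + r * p.toReal)

end GreedyBisection

end

open GreedyBisection

/-! An element marked by GREEDY is bisected at once and never reappears, so a run marks each node of
the infinite bisection forest at most once. Moreover a marked node is large: `δ < C₀ h_T^r |g|_T`.
Both termination and the bound follow if the number of large nodes is at most `C |g|^e δ^(-e)`, with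
`e` the exponent of the theorem (`card_le_of_large`). The run is controlled by the number of large
nodes not yet bisected, which drops in each pass by at least the number of marked elements
(`GreedyStep.card_add_le`).

Large nodes are counted generation by generation. Volumes halve, so `h_T^r` is a constant times
`2^(-kr/d)` in generation `k`, and the `ℓ_p` bound over all nodes of that generation leaves at most
`x^p 2^(-krp/d)` large ones, where `x` is a constant times `|g| / δ`. There are also at most `M 2^k`
nodes in all. The two bounds balance at `2^k ≈ Y = x^e`; below this threshold the second gives a
geometric sum of order `Y`, above it the first does. For `p = ∞` there are no large nodes above the
threshold.

The `ℓ_p` bound is available only for meshes of the forest, so the nodes of a fixed generation must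
form a conforming mesh (`conf_of_generation_eq`). This is where the admissible labeling enters. Any
two simplices of equal generation are shown by induction to meet in a common face and to carry
compatible labels. Compatibility forces a refinement edge of one that lies in the other to be the
refinement edge of both, so bisecting both keeps the intersection a common face (`Conf.firstChild`).

The loop can be carried out only if REFINE has a result (`exists_isREFINE`). Deep uniform meshes
supply conforming refinements. A mesh is encoded by its finite set of bisected nodes, and
intersecting two such sets for conforming meshes gives a conforming mesh again: no hanging nodes
arise, and comparison with a uniform mesh shows that their absence suffices. A refinement with
fewest bisected nodes is then the coarsest. -/

namespace GreedyBisection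

/-! ### Bisection meshes as leaf sets of finite binary forests -/

section Forest

variable {M : ℕ}

/-- A set of nodes of the forest that contains the parents of its members. -/
def IsAncestral (I : Finset (Elem M)) : Prop :=
  ∀ (T : Elem M) (b : Bool), T.child b ∈ I → T ∈ I

/-- The nodes directly below a set of nodes. -/
def IsLeaf (I : Finset (Elem M)) (T : Elem M) : Prop :=
  T ∉ I ∧ ∀ (S : Elem M) (b : Bool), T = S.child b → S ∈ I

/-- `I` is the set of bisected nodes of the mesh `𝒯`. -/
def IsInterior (I 𝒯 : Finset (Elem M)) : Prop :=
  IsAncestral I ∧ ∀ T, T ∈ 𝒯 ↔ IsLeaf I T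

theorem Elem.child_inj {S T : Elem M} {b c : Bool} :
    S.child b = T.child c ↔ S = T ∧ b = c := by
  obtain ⟨i, u⟩ := S
  obtain ⟨j, w⟩ := T
  simp only [Elem.child, Prod.mk.injEq, List.cons.injEq]
  tauto

theorem Elem.child_ne_root (T : Elem M) (b : Bool) (i : Fin M) : T.child b ≠ (i, []) := by
  simp [Elem.child]

theorem Elem.child_ne_self (T : Elem M) (b : Bool) : T.child b ≠ T := by
  intro h
  have := congrArg (fun S : Elem M => S.2.length) h
  simp [Elem.child] at this

theorem Elem.root_or_child (T : Elem M) : (∃ i, T = (i, [])) ∨ ∃ S b, T = Elem.child S b := by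
  obtain ⟨i, w⟩ := T
  cases w with
  | nil => exact Or.inl ⟨i, rfl⟩
  | cons b w => exact Or.inr ⟨(i, w), b, rfl⟩

theorem Elem.IsDescendant.refl (T : Elem M) : T.IsDescendant T := ⟨rfl, List.suffix_refl _⟩

theorem Elem.IsDescendant.trans {R S T : Elem M} (h : R.IsDescendant S) (h' : S.IsDescendant T) :
    R.IsDescendant T := ⟨h.1.trans h'.1, h.2.trans h'.2⟩

theorem Elem.isDescendant_child (T : Elem M) (b : Bool) : T.IsDescendant (T.child b) :=
  ⟨rfl, List.suffix_cons _ _⟩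

theorem Elem.isDescendant_child_iff {S T : Elem M} {b : Bool} :
    S.IsDescendant (T.child b) ↔ S = T.child b ∨ S.IsDescendant T := by
  obtain ⟨i, u⟩ := S
  obtain ⟨j, w⟩ := T
  simp only [Elem.IsDescendant, Elem.child, List.suffix_cons_iff, Prod.mk.injEq]
  tauto

theorem Elem.IsDescendant.antisymm {S T : Elem M} (h : S.IsDescendant T) (h' : T.IsDescendant S) :
    S = T :=
  Prod.ext h.1 (h.2.eq_of_length_le h'.2.length_le)

@[simp] theorem Elem.generation_child (T : Elem M) (b : Bool) :
    (T.child b).generation = T.generation + 1 := rfl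

theorem Elem.IsDescendant.generation_le {S T : Elem M} (h : S.IsDescendant T) :
    S.generation ≤ T.generation := h.2.length_le

/-- Induction along the forest. -/
theorem Elem.induction {P : Elem M → Prop} (root : ∀ i, P (i, []))
    (child : ∀ T b, P T → P (Elem.child T b)) (T : Elem M) : P T := by
  obtain ⟨i, w⟩ := T
  induction w with
  | nil => exact root i
  | cons b w ih => exact child (i, w) b ih

theorem IsAncestral.mem_of_isDescendant {I : Finset (Elem M)} (hI : IsAncestral I) {S T : Elem M}
    (h : S.IsDescendant T) (hT : T ∈ I) : S ∈ I := by
  induction T using Elem.induction with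
  | root i =>
    have : S = (i, []) := h.antisymm ⟨h.1.symm, List.nil_suffix⟩
    rwa [this]
  | child T b ih =>
    rcases Elem.isDescendant_child_iff.1 h with rfl | h
    · exact hT
    · exact ih h (hI _ _ hT)

/-- Climb from `T` towards the root while the parent is still outside `I`. -/
theorem exists_isLeaf_isDescendant {I : Finset (Elem M)} {T : Elem M} (hT : T ∉ I) :
    ∃ S, IsLeaf I S ∧ S.IsDescendant T := by
  induction T using Elem.induction with
  | root i => exact ⟨_, ⟨hT, fun S b h => absurd h.symm (S.child_ne_root b i)⟩, .refl _⟩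
  | child T b ih =>
    by_cases h : T ∈ I
    · refine ⟨_, ⟨hT, fun S c hS => ?_⟩, .refl _⟩
      rwa [← (Elem.child_inj.1 hS).1]
    · obtain ⟨S, hS, hST⟩ := ih h
      exact ⟨S, hS, hST.trans (T.isDescendant_child b)⟩

/-- A proper ancestor of a leaf is an ancestor of its parent, hence lies in `I` and is no leaf
itself. -/
theorem IsLeaf.eq_of_isDescendant {I : Finset (Elem M)} (hI : IsAncestral I) {S T : Elem M}
    (hS : IsLeaf I S) (hT : IsLeaf I T) (h : S.IsDescendant T) : S = T := by
  rcases T.root_or_child with ⟨i, rfl⟩ | ⟨R, b, rfl⟩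
  · exact h.antisymm ⟨h.1.symm, List.nil_suffix⟩
  · rcases Elem.isDescendant_child_iff.1 h with rfl | h
    · rfl
    · exact absurd (hI.mem_of_isDescendant h (hT.2 R b rfl)) hS.1

theorem isInterior_initialMesh : IsInterior ∅ (initialMesh M) := by
  refine ⟨fun _ _ h => by simp at h, fun T => ?_⟩
  rcases T.root_or_child with ⟨i, rfl⟩ | ⟨R, b, rfl⟩
  · simp [initialMesh, IsLeaf, Elem.child]
  · simp only [initialMesh, IsLeaf, Finset.mem_image, Finset.mem_univ, true_and, Finset.notMem_empty,
      not_false_eq_true, imp_false]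
    constructor
    · rintro ⟨i, hi⟩
      exact absurd hi.symm (R.child_ne_root b i)
    · intro h
      exact absurd rfl (h R b)

theorem IsInterior.bisect {I 𝒯 : Finset (Elem M)} (h : IsInterior I 𝒯) {T : Elem M} (hT : T ∈ 𝒯) :
    IsInterior (insert T I) (𝒯.erase T ∪ {T.child false, T.child true}) := by
  have hTI := (h.2 T).1 hT
  refine ⟨fun S b hS => ?_, fun S => ?_⟩
  · rcases Finset.mem_insert.1 hS with hS | hS
    · exact Finset.mem_insert_of_mem (hTI.2 S b hS.symm)
    · exact Finset.mem_insert_of_mem (h.1 S b hS)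
  · have hc : ∀ b, T.child b ∉ I := fun b hb => hTI.1 (h.1 T b hb)
    have key : S ∈ ({T.child false, T.child true} : Finset (Elem M)) ↔ ∃ b, S = T.child b := by
      simp
    rw [Finset.mem_union, key, Finset.mem_erase, h.2]
    constructor
    · rintro (⟨hne, hS⟩ | ⟨b, rfl⟩)
      · exact ⟨by simp [hne, hS.1], fun R b hR => Finset.mem_insert_of_mem (hS.2 R b hR)⟩
      · refine ⟨by simp [T.child_ne_self b, hc b], fun R c hR => ?_⟩
        rw [← (Elem.child_inj.1 hR).1]
        exact Finset.mem_insert_self _ _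
    · rintro ⟨hS, hS'⟩
      rw [Finset.mem_insert, not_or] at hS
      by_cases hb : ∃ b, S = T.child b
      · exact Or.inr hb
      · refine Or.inl ⟨hS.1, hS.2, fun R b hR => ?_⟩
        rcases Finset.mem_insert.1 (hS' R b hR) with rfl | hR'
        · exact absurd ⟨b, hR⟩ hb
        · exact hR'

theorem IsBisectionMesh.exists_isInterior {𝒯 : Finset (Elem M)} (h : IsBisectionMesh 𝒯) :
    ∃ I, IsInterior I 𝒯 := by
  induction h with
  | init => exact ⟨∅, isInterior_initialMesh⟩
  | bisect 𝒯 T _ hT ih =>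
    obtain ⟨I, hI⟩ := ih
    exact ⟨_, hI.bisect hT⟩

/-- A node of maximal generation in `I` can be removed without losing ancestrality. It is then an
element of the mesh obtained for the remaining nodes, and bisecting it last restores `I`. -/
theorem IsAncestral.exists_isBisectionMesh {I : Finset (Elem M)} (h : IsAncestral I) :
    ∃ 𝒯, IsBisectionMesh 𝒯 ∧ IsInterior I 𝒯 := by
  induction hn : I.card generalizing I with
  | zero =>
    rw [Finset.card_eq_zero] at hn
    subst hn
    exact ⟨_, .init, isInterior_initialMesh⟩
  | succ n ih =>
    obtain ⟨T, hT, hmax⟩ := I.exists_max_image Elem.generation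
      (Finset.card_pos.1 (by omega))
    have hlow : ∀ b, T.child b ∉ I := fun b hb => by
      have := hmax _ hb
      simp at this
    have hI' : IsAncestral (I.erase T) := fun S b hS => by
      rw [Finset.mem_erase] at hS ⊢
      refine ⟨?_, h S b hS.2⟩
      rintro rfl
      exact hlow b hS.2
    obtain ⟨𝒯, h𝒯, hint⟩ := ih hI' (by rw [Finset.card_erase_of_mem hT, hn]; rfl)
    have hT𝒯 : T ∈ 𝒯 := by
      refine (hint.2 T).2 ⟨Finset.notMem_erase _ _, fun S b hS => ?_⟩
      rw [Finset.mem_erase]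
      subst hS
      exact ⟨(S.child_ne_self b).symm, h S b hT⟩
    refine ⟨_, .bisect 𝒯 T h𝒯 hT𝒯, ?_⟩
    have := hint.bisect hT𝒯
    rwa [Finset.insert_erase hT] at this

/-- Turns the order of refinement into inclusion of finite sets, so that meshes can be intersected
and counted. -/
theorem IsInterior.refines_iff {I I' 𝒯 𝒯' : Finset (Elem M)} (h : IsInterior I 𝒯)
    (h' : IsInterior I' 𝒯') : Refines 𝒯' 𝒯 ↔ I ⊆ I' := by
  constructor
  · intro href T hT
    by_contra hT'
    obtain ⟨S, hS, hST⟩ := exists_isLeaf_isDescendant hT'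
    obtain ⟨R, hR, hRS⟩ := href S ((h'.2 S).2 hS)
    exact ((h.2 R).1 hR).1 (h.1.mem_of_isDescendant (hRS.trans hST) hT)
  · intro hsub T' hT'
    have hT := fun h0 => ((h'.2 T').1 hT').1 (hsub h0)
    obtain ⟨S, hS, hST⟩ := exists_isLeaf_isDescendant hT
    exact ⟨S, (h.2 S).2 hS, hST⟩

/-- The parent of `T`, if any, is bisected in both meshes, while `T` is left unbisected in at least
one of them. `T` is an element of that mesh, and either bisected or an element in the other. -/
theorem IsInterior.mem_of_isLeaf_inter {I₁ I₂ 𝒯₁ 𝒯₂ : Finset (Elem M)} (h₁ : IsInterior I₁ 𝒯₁)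
    (h₂ : IsInterior I₂ 𝒯₂) {T : Elem M} (hT : IsLeaf (I₁ ∩ I₂) T) :
    (T ∈ 𝒯₁ ∧ (T ∈ I₂ ∨ T ∈ 𝒯₂)) ∨ (T ∈ 𝒯₂ ∧ (T ∈ I₁ ∨ T ∈ 𝒯₁)) := by
  have hp₁ : ∀ S b, T = Elem.child S b → S ∈ I₁ := fun S b h => (Finset.mem_inter.1 (hT.2 S b h)).1
  have hp₂ : ∀ S b, T = Elem.child S b → S ∈ I₂ := fun S b h => (Finset.mem_inter.1 (hT.2 S b h)).2
  have hn := hT.1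
  rw [Finset.mem_inter] at hn
  rw [h₁.2, h₂.2]
  unfold IsLeaf
  tauto

theorem IsAncestral.inter {I₁ I₂ : Finset (Elem M)} (h₁ : IsAncestral I₁) (h₂ : IsAncestral I₂) :
    IsAncestral (I₁ ∩ I₂) := fun T b h => by
  rw [Finset.mem_inter] at h ⊢
  exact ⟨h₁ T b h.1, h₂ T b h.2⟩

theorem finite_generation_lt (M k : ℕ) : {T : Elem M | T.generation < k}.Finite := by
  refine ((Set.finite_univ (α := Fin M)).prod (List.finite_length_lt Bool k)).subset ?_
  rintro ⟨i, w⟩ h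
  exact ⟨trivial, h⟩

/-- The nodes of generation less than `k`. -/
noncomputable def nodesBelow (M k : ℕ) : Finset (Elem M) := (finite_generation_lt M k).toFinset

@[simp] theorem mem_nodesBelow {k : ℕ} {T : Elem M} : T ∈ nodesBelow M k ↔ T.generation < k := by
  simp [nodesBelow]

theorem isAncestral_nodesBelow (k : ℕ) : IsAncestral (nodesBelow M k) := fun T b h => by
  simp only [mem_nodesBelow, Elem.generation_child] at h ⊢
  omega

theorem isLeaf_nodesBelow {k : ℕ} {T : Elem M} : IsLeaf (nodesBelow M k) T ↔ T.generation = k := by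
  rcases T.root_or_child with ⟨i, rfl⟩ | ⟨R, b, rfl⟩
  · simp only [IsLeaf, mem_nodesBelow, not_lt]
    constructor
    · rintro ⟨h, -⟩
      exact le_antisymm (Nat.zero_le _) h
    · intro h
      exact ⟨h.ge, fun S b hS => absurd hS.symm (S.child_ne_root b i)⟩
  · simp only [IsLeaf, mem_nodesBelow, not_lt, Elem.generation_child]
    constructor
    · rintro ⟨h, h'⟩
      have := h' R b rfl
      omega
    · intro h
      refine ⟨h.ge, fun S c hS => ?_⟩
      rw [← (Elem.child_inj.1 hS).1]
      omega

/-- The mesh of all elements of generation `k`. -/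
theorem exists_uniformMesh (M k : ℕ) : ∃ 𝒰 : Finset (Elem M), IsBisectionMesh 𝒰 ∧
    IsInterior (nodesBelow M k) 𝒰 ∧ ∀ T, T ∈ 𝒰 ↔ T.generation = k := by
  obtain ⟨𝒰, h, h'⟩ := (isAncestral_nodesBelow (M := M) k).exists_isBisectionMesh
  exact ⟨𝒰, h, h', fun T => by rw [h'.2, isLeaf_nodesBelow]⟩

/-- A property of nodes that passes from every node to one of its children passes from the bisected
nodes of a mesh to its elements. -/
theorem IsInterior.exists_of_child {I 𝒯 : Finset (Elem M)} (h : IsInterior I 𝒯) {P : Elem M → Prop}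
    (hP : ∀ T, P T → ∃ b, P (Elem.child T b)) {T : Elem M} (hT : T ∈ I ∨ T ∈ 𝒯) (hPT : P T) :
    ∃ S ∈ 𝒯, P S := by
  classical
  rcases hT with hT | hT
  · obtain ⟨S, hS, hmax⟩ := (I.filter P).exists_max_image Elem.generation
      ⟨T, Finset.mem_filter.2 ⟨hT, hPT⟩⟩
    rw [Finset.mem_filter] at hS
    obtain ⟨b, hb⟩ := hP S hS.2
    refine ⟨S.child b, (h.2 _).2 ⟨fun hc => ?_, fun R c hR => ?_⟩, hb⟩
    · have := hmax _ (Finset.mem_filter.2 ⟨hc, hb⟩)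
      simp at this
    · rw [← (Elem.child_inj.1 hR).1]
      exact hS.1
  · exact ⟨T, hT, hPT⟩

end Forest

/-! ### Convex geometry of bisected simplices -/

section Convex

variable {V : Type*} [AddCommGroup V] [Module ℝ V]

theorem affine_nonneg_of_mem_convexHull {s : Set V} (c : V →ᵃ[ℝ] ℝ) (h : ∀ v ∈ s, 0 ≤ c v) {z : V}
    (hz : z ∈ convexHull ℝ s) : 0 ≤ c z :=
  convexHull_min (t := c ⁻¹' Set.Ici 0) h ((convex_Ici 0).affine_preimage c) hz

/-- The hull of a set meets a supporting hyperplane in the hull of the points that lie on it. -/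
theorem mem_convexHull_inter_zero {s : Set V} (c : V →ᵃ[ℝ] ℝ) (h : ∀ v ∈ s, c v ≤ 0) {z : V}
    (hz : z ∈ convexHull ℝ s) (hcz : 0 ≤ c z) : z ∈ convexHull ℝ (s ∩ {v | c v = 0}) := by
  set H := convexHull ℝ (s ∩ {v | c v = 0}) with hH
  have hH0 : ∀ v ∈ H, c v = 0 := fun v hv =>
    convexHull_min (t := c ⁻¹' {0}) (fun w hw => hw.2) ((convex_singleton 0).affine_preimage c) hv
  -- A combination with positive weights of a point where `c < 0` and a point where `c ≤ 0` again
  -- satisfies `c < 0`.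
  have hconv : Convex ℝ ({v | c v < 0} ∪ H) := by
    rw [convex_iff_forall_pos]
    intro x hx y hy a b ha hb hab
    have hc : c (a • x + b • y) = a * c x + b * c y := by
      have := Convex.combo_affine_apply (f := c) (x := x) (y := y) hab
      simpa using this
    rcases hx with hx | hx
    · left
      have hy' : c y ≤ 0 := hy.elim (fun h => le_of_lt h) (fun h => (hH0 y h).le)
      simp only [Set.mem_ofPred_eq] at hx ⊢
      rw [hc]
      nlinarith
    · rcases hy with hy | hy
      · left
        have hx' := hH0 x hx
        simp only [Set.mem_ofPred_eq] at hy ⊢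
        rw [hc]
        nlinarith
      · exact Or.inr ((convex_convexHull ℝ _) hx hy ha.le hb.le hab)
  have hsub : s ⊆ {v | c v < 0} ∪ H := fun v hv => by
    rcases (h v hv).lt_or_eq with h' | h'
    · exact Or.inl h'
    · exact Or.inr (subset_convexHull ℝ _ ⟨hv, h'⟩)
  rcases convexHull_min hsub hconv hz with h' | h'
  · exact absurd hcz (not_le.2 h')
  · exact h'

/-- The part of a simplex on one side of the bisecting hyperplane. -/
theorem mem_convexHull_bisect {s : Set V} {x y : V} (c : V →ᵃ[ℝ] ℝ) (hx : c x = 1) (hy : c y = -1)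
    (hs : ∀ v ∈ s, c v = 0) {z : V} (hz : z ∈ convexHull ℝ (insert x (insert y s)))
    (hcz : 0 ≤ c z) : z ∈ convexHull ℝ (insert x (insert (midpoint ℝ x y) s)) := by
  set m := midpoint ℝ x y with hm
  have hcm : c m = 0 := by
    rw [hm, AffineMap.map_midpoint, hx, hy]
    simp [midpoint_eq_smul_add]
  have hm2 : m = (1 / 2 : ℝ) • x + (1 / 2 : ℝ) • y := by
    rw [hm, midpoint_eq_smul_add, smul_add]
    norm_num
  set A := convexHull ℝ (insert m s) with hA
  have hAne : A.Nonempty := ⟨m, subset_convexHull ℝ _ (Set.mem_insert _ _)⟩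
  have hA0 : ∀ v ∈ A, c v = 0 := fun v hv =>
    convexHull_min (t := c ⁻¹' {0}) (by
      rintro w (rfl | hw)
      · exact hcm
      · exact hs w hw) ((convex_singleton 0).affine_preimage c) hv
  have hz' : z ∈ convexHull ℝ (insert x (insert y A)) := by
    refine convexHull_mono (Set.insert_subset_insert (Set.insert_subset_insert ?_)) hz
    exact (Set.subset_insert _ _).trans (subset_convexHull ℝ _)
  rw [convexHull_insert ⟨y, Set.mem_insert _ _⟩, convexHull_insert hAne,
    (convex_convexHull ℝ _).convexHull_eq] at hz'
  simp only [convexJoin_singleton_left, Set.mem_iUnion] at hz'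
  obtain ⟨u, ⟨a, haA, b₁, b₂, hb₁, hb₂, hb, rfl⟩, a₁, a₂, ha₁, ha₂, ha, rfl⟩ := hz'
  have hc1 : c (b₁ • y + b₂ • a) = -b₁ := by
    have := Convex.combo_affine_apply (f := c) (x := y) (y := a) hb
    rw [this, hy, hA0 a haA]
    simp
  have hc2 : c (a₁ • x + a₂ • (b₁ • y + b₂ • a)) = a₁ - a₂ * b₁ := by
    have := Convex.combo_affine_apply (f := c) (x := x) (y := b₁ • y + b₂ • a) ha
    rw [this, hc1, hx]
    simp
    ring
  rw [hc2] at hcz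
  set B := convexHull ℝ (insert x (insert m s)) with hB
  have hxB : x ∈ B := subset_convexHull ℝ _ (Set.mem_insert _ _)
  have hmB : m ∈ B := subset_convexHull ℝ _ (Set.mem_insert_of_mem _ (Set.mem_insert _ _))
  have haB : a ∈ B := convexHull_mono (Set.subset_insert _ _) haA
  -- Substituting `y = 2m - x` in the convex combination for `z` yields these weights; the weight of
  -- `x` is `c z`, which is nonnegative by assumption.
  have hmem := (convex_convexHull ℝ (insert x (insert m s))).sum_mem (t := Finset.univ)
    (w := ![a₁ - a₂ * b₁, 2 * (a₂ * b₁), a₂ * b₂]) (z := ![x, m, a]) (by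
      intro i _
      fin_cases i
      · exact hcz
      · exact mul_nonneg zero_le_two (mul_nonneg ha₂ hb₁)
      · exact mul_nonneg ha₂ hb₂) (by
      simp only [Fin.sum_univ_three, Matrix.cons_val_zero, Matrix.cons_val_one, Matrix.cons_val]
      linear_combination ha + a₂ * hb) (by
      intro i _
      fin_cases i
      · exact hxB
      · exact hmB
      · exact haB)
  simp only [Fin.sum_univ_three, Matrix.cons_val_zero, Matrix.cons_val_one, Matrix.cons_val] at hmem
  convert hmem using 1
  rw [hm2]
  module

end Convex

/-! ### Reflection, children and conformity of tagged simplices -/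

namespace TaggedSimplex

section Vertices

variable {V : Type*} {d : ℕ}

theorem reflectIdx_involutive (d γ : ℕ) : Function.Involutive (reflectIdx d γ) := by
  intro j
  have hj := j.isLt
  by_cases h0 : j = 0
  · subst h0
    by_cases hd : Fin.last d = 0
    · simp [reflectIdx, hd]
    · simp [reflectIdx, hd]
  by_cases hl : j = Fin.last d
  · subst hl
    simp [reflectIdx, h0]
  by_cases hγ : γ < j.val
  · have h0' : j.val ≠ 0 := fun h => h0 (Fin.ext h)
    have hl' : j.val ≠ d := fun h => hl (Fin.ext h)
    have h1 : reflectIdx d γ j = ⟨d + γ - j.val, by omega⟩ := by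
      simp [reflectIdx, h0, hl, hγ]
    rw [h1]
    unfold reflectIdx
    rw [if_neg (by simp only [Fin.ext_iff, Fin.val_zero]; omega),
      if_neg (by simp only [Fin.ext_iff, Fin.val_last]; omega),
      dif_pos (by simp only; omega)]
    apply Fin.ext
    simp only
    omega
  · have h1 : reflectIdx d γ j = j := by simp [reflectIdx, h0, hl, hγ]
    rw [h1, h1]

@[simp] theorem reflect_type (t : TaggedSimplex V d) : t.reflect.type = t.type := rfl

@[simp] theorem reflect_reflect (t : TaggedSimplex V d) : t.reflect.reflect = t := by
  obtain ⟨v, γ⟩ := t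
  simp only [reflect, mk.injEq, and_true]
  funext j
  simp [reflectIdx_involutive d γ j]

@[simp] theorem reflect_vertices (t : TaggedSimplex V d) : t.reflect.vertices = t.vertices :=
  (reflectIdx_involutive d t.type).surjective.range_comp _

theorem reflect_vert_zero (t : TaggedSimplex V d) : t.reflect.vert 0 = t.vert (Fin.last d) := by
  simp [reflect, reflectIdx]

theorem reflect_vert_last (t : TaggedSimplex V d) : t.reflect.vert (Fin.last d) = t.vert 0 := by
  have := reflect_vert_zero t.reflect
  rw [reflect_reflect] at this
  exact this.symm

@[simp] theorem reflect_refinementEdge (t : TaggedSimplex V d) :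
    t.reflect.refinementEdge = t.refinementEdge := by
  simp only [refinementEdge, reflect_vert_zero, reflect_vert_last, Set.pair_comm]

theorem refinementEdge_subset (t : TaggedSimplex V d) : t.refinementEdge ⊆ t.vertices := by
  rintro v (rfl | rfl)
  · exact ⟨_, rfl⟩
  · exact ⟨_, rfl⟩

/-- If the refinement edge of `t` belongs to `t'` then it is the refinement edge of `t'`. -/
def EdgeCompat (t t' : TaggedSimplex V d) : Prop :=
  t.refinementEdge ⊆ t'.vertices → t.refinementEdge = t'.refinementEdge

end Vertices

variable {V : Type*} {d : ℕ} [AddCommGroup V] [Module ℝ V]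

/-- The vertices are affinely independent: every prescription of values at the vertices is
interpolated by an affine functional. -/
def Nondeg (t : TaggedSimplex V d) : Prop :=
  ∀ a : Fin (d + 1) → ℝ, ∃ f : V →ᵃ[ℝ] ℝ, ∀ j, f (t.vert j) = a j

@[simp] theorem reflect_region (t : TaggedSimplex V d) : t.reflect.region = t.region := by
  simp [region]

/-- The midpoint of the refinement edge. -/
noncomputable def mid (t : TaggedSimplex V d) : V := midpoint ℝ (t.vert 0) (t.vert (Fin.last d))

theorem child_eq_firstChild (t : TaggedSimplex V d) (b : Bool) :
    t.child b = (if b then t.reflect else t).firstChild := by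
  cases b <;> rfl

@[simp] theorem firstChild_type (t : TaggedSimplex V d) :
    t.firstChild.type = (t.type + 1) % d := rfl

@[simp] theorem firstChild_vert_zero (t : TaggedSimplex V d) : t.firstChild.vert 0 = t.vert 0 := rfl

theorem firstChild_vert_one (t : TaggedSimplex V d) {j : Fin (d + 1)} (hj : j.val = 1) :
    t.firstChild.vert j = t.mid := by
  cases j using Fin.cases with
  | zero => simp at hj
  | succ k =>
    simp only [Fin.val_succ, Nat.add_eq_right] at hj
    simp [firstChild, mid, hj]

theorem firstChild_vert_of_one_lt (t : TaggedSimplex V d) {j i : Fin (d + 1)} (hj : 1 < j.val)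
    (hi : i.val + 1 = j.val) : t.firstChild.vert j = t.vert i := by
  cases j using Fin.cases with
  | zero => simp at hj
  | succ k =>
    simp only [Fin.val_succ, Nat.lt_add_left_iff_pos, Nat.add_right_cancel_iff] at hj hi
    have : i = k.castSucc := Fin.ext hi
    subst this
    simp [firstChild, hj.ne']

theorem Nondeg.injective {t : TaggedSimplex V d} (h : t.Nondeg) : Function.Injective t.vert := by
  obtain ⟨f, hf⟩ := h (fun j => (j.val : ℝ))
  intro i j hij
  have : (i.val : ℝ) = j.val := by rw [← hf, ← hf, hij]
  exact Fin.ext (by exact_mod_cast this)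

theorem Nondeg.reflect {t : TaggedSimplex V d} (h : t.Nondeg) : t.reflect.Nondeg := fun a => by
  obtain ⟨f, hf⟩ := h (a ∘ reflectIdx d t.type)
  refine ⟨f, fun j => ?_⟩
  simp [TaggedSimplex.reflect, hf, reflectIdx_involutive d t.type j]

theorem map_mid (t : TaggedSimplex V d) (f : V →ᵃ[ℝ] ℝ) :
    f t.mid = (f (t.vert 0) + f (t.vert (Fin.last d))) / 2 := by
  rw [mid, AffineMap.map_midpoint, midpoint_eq_smul_add]
  simp only [invOf_eq_inv, smul_eq_mul]
  ring

theorem Nondeg.firstChild {t : TaggedSimplex V d} (hd : 0 < d) (h : t.Nondeg) :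
    t.firstChild.Nondeg := fun a => by
  -- The midpoint has position 1 in the child, and the value at `x_d` is chosen so that its mean
  -- with `a 0` is `a 1`.
  obtain ⟨f, hf⟩ := h fun j => if hj : j = Fin.last d then 2 * a ⟨1, by omega⟩ - a 0 else
    if j = 0 then a 0 else a ⟨j.val + 1, by
      have : j.val ≠ d := fun h => hj (Fin.ext h)
      omega⟩
  have h0 : (0 : Fin (d + 1)) ≠ Fin.last d := fun h => by
    simp only [Fin.ext_iff, Fin.val_zero, Fin.val_last] at h
    omega
  refine ⟨f, fun j => ?_⟩
  rcases Nat.lt_trichotomy j.val 1 with hj | hj | hj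
  · obtain rfl : j = 0 := Fin.ext (by simpa using hj)
    rw [firstChild_vert_zero, hf, dif_neg h0, if_pos rfl]
  · rw [firstChild_vert_one t hj, map_mid, hf, hf, dif_neg h0, if_pos rfl, dif_pos rfl]
    have : j = ⟨1, by omega⟩ := Fin.ext hj
    rw [this]
    ring
  · have hi : j.val - 1 < d + 1 := by omega
    rw [firstChild_vert_of_one_lt t (i := ⟨j.val - 1, hi⟩) hj (by simp; omega), hf,
      dif_neg (by simp [Fin.ext_iff]; omega), if_neg (by simp [Fin.ext_iff]; omega)]
    congr 1
    apply Fin.ext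
    simp
    omega

theorem Nondeg.child {t : TaggedSimplex V d} (hd : 0 < d) (h : t.Nondeg) (b : Bool) :
    (t.child b).Nondeg := by
  cases b
  · exact h.firstChild hd
  · exact h.reflect.firstChild hd

theorem mem_firstChild_vertices {t : TaggedSimplex V d} (hd : 0 < d) {v : V} :
    v ∈ t.firstChild.vertices ↔ v = t.mid ∨ ∃ j, j ≠ Fin.last d ∧ t.vert j = v := by
  constructor
  · rintro ⟨j, rfl⟩
    rcases Nat.lt_trichotomy j.val 1 with hj | hj | hj
    · obtain rfl : j = 0 := Fin.ext (by simpa using hj)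
      refine Or.inr ⟨0, fun h => ?_, rfl⟩
      simp only [Fin.ext_iff, Fin.val_zero, Fin.val_last] at h
      omega
    · exact Or.inl (firstChild_vert_one t hj)
    · have hi : j.val - 1 < d + 1 := by omega
      refine Or.inr ⟨⟨j.val - 1, hi⟩, fun h => ?_,
        (firstChild_vert_of_one_lt t (i := ⟨j.val - 1, hi⟩) hj (by simp; omega)).symm⟩
      simp [Fin.ext_iff] at h
      omega
  · rintro (rfl | ⟨j, hj, rfl⟩)
    · exact ⟨⟨1, by omega⟩, firstChild_vert_one t rfl⟩
    · by_cases h0 : j = 0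
      · exact ⟨0, by rw [h0, firstChild_vert_zero]⟩
      · have hj' : j.val ≠ d := fun h => hj (Fin.ext h)
        have h0' : j.val ≠ 0 := fun h => h0 (Fin.ext h)
        exact ⟨⟨j.val + 1, by omega⟩, firstChild_vert_of_one_lt t (by simp only; omega) rfl⟩

theorem mem_firstChild_of_ne {t : TaggedSimplex V d} (hd : 0 < d) {v : V} (hv : v ∈ t.vertices)
    (hne : v ≠ t.vert (Fin.last d)) : v ∈ t.firstChild.vertices := by
  obtain ⟨j, rfl⟩ := hv
  exact (mem_firstChild_vertices hd).2 (Or.inr ⟨j, fun h => hne (by rw [h]), rfl⟩)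

theorem mid_mem_region (t : TaggedSimplex V d) : t.mid ∈ t.region :=
  (convex_convexHull ℝ _).midpoint_mem (subset_convexHull ℝ _ ⟨_, rfl⟩)
    (subset_convexHull ℝ _ ⟨_, rfl⟩)

theorem firstChild_region_subset (hd : 0 < d) (t : TaggedSimplex V d) :
    t.firstChild.region ⊆ t.region := by
  refine convexHull_min (fun v hv => ?_) (convex_convexHull ℝ _)
  rcases (mem_firstChild_vertices hd).1 hv with rfl | ⟨j, -, rfl⟩
  · exact t.mid_mem_region
  · exact subset_convexHull ℝ _ ⟨j, rfl⟩

theorem child_region_subset (hd : 0 < d) (t : TaggedSimplex V d) (b : Bool) :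
    (t.child b).region ⊆ t.region := by
  cases b
  · exact firstChild_region_subset hd t
  · exact (firstChild_region_subset hd t.reflect).trans_eq (reflect_region t)

theorem Nondeg.zero_ne_last {t : TaggedSimplex V d} (hd : 0 < d) (h : t.Nondeg) :
    t.vert 0 ≠ t.vert (Fin.last d) := fun h' => by
  have := congrArg Fin.val (h.injective h')
  simp only [Fin.val_zero, Fin.val_last] at this
  omega

/-- An old vertex belongs to one of the children. -/
theorem Nondeg.exists_mem_child {t : TaggedSimplex V d} (hd : 0 < d) (h : t.Nondeg) {v : V}
    (hv : v ∈ t.vertices) : ∃ b, v ∈ (t.child b).vertices := by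
  by_cases hl : v = t.vert (Fin.last d)
  · refine ⟨true, mem_firstChild_of_ne hd (by simpa using hv) ?_⟩
    rw [reflect_vert_last, hl]
    exact (h.zero_ne_last hd).symm
  · exact ⟨false, mem_firstChild_of_ne hd hv hl⟩

/-- The value `1` at a given vertex and `0` at all the others. -/
theorem Nondeg.exists_coord {t : TaggedSimplex V d} (h : t.Nondeg) (j : Fin (d + 1)) :
    ∃ f : V →ᵃ[ℝ] ℝ, f (t.vert j) = 1 ∧ ∀ i, i ≠ j → f (t.vert i) = 0 := by
  obtain ⟨f, hf⟩ := h (fun i => if i = j then 1 else 0)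
  exact ⟨f, by simp [hf], fun i hi => by simp [hf, hi]⟩

theorem Nondeg.mid_notMem {t : TaggedSimplex V d} (hd : 0 < d) (h : t.Nondeg) :
    t.mid ∉ t.vertices := by
  rintro ⟨j, hj⟩
  -- The midpoint receives the value 1, which no vertex has.
  obtain ⟨f, hf⟩ := h (fun i => if i = 0 then 0 else if i = Fin.last d then 2 else 3)
  have h0 : Fin.last d ≠ 0 := fun h => by
    simp only [Fin.ext_iff, Fin.val_zero, Fin.val_last] at h
    omega
  have h1 := hf j
  rw [hj, map_mid, hf, hf] at h1
  simp only [↓reduceIte, h0] at h1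
  split_ifs at h1 <;> norm_num at h1

/-- Vertices are extreme points. -/
theorem Nondeg.mem_of_mem_convexHull {t : TaggedSimplex V d} (h : t.Nondeg) {s : Set V} {v : V}
    (hv : v ∈ t.vertices) (hs : s ⊆ t.vertices) (hvs : v ∈ convexHull ℝ s) : v ∈ s := by
  by_contra hn
  obtain ⟨j, rfl⟩ := hv
  obtain ⟨f, hf, hf'⟩ := h.exists_coord j
  have : f (t.vert j) = 0 := convexHull_min (t := f ⁻¹' {0}) (fun w hw => by
      obtain ⟨i, rfl⟩ := hs hw
      exact hf' i fun hij => hn (hij ▸ hw)) ((convex_singleton 0).affine_preimage f) hvs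
  rw [hf] at this
  exact one_ne_zero this

/-- The part of a set inside a face of a simplex. -/
theorem Nondeg.convexHull_inter_face {t : TaggedSimplex V d} (h : t.Nondeg) {F s : Set V}
    (hF : F ⊆ t.vertices) (hs : s ⊆ t.region) {z : V} (hz : z ∈ convexHull ℝ s)
    (hzF : z ∈ convexHull ℝ F) : z ∈ convexHull ℝ (s ∩ convexHull ℝ F) := by
  classical
  -- This functional exposes the face: it is nonpositive on the simplex and vanishes exactly on the
  -- hull of `F`.
  obtain ⟨f, hf⟩ := h (fun i => if t.vert i ∈ F then 0 else -1)
  have hle : ∀ v ∈ t.region, f v ≤ 0 := fun v hv => by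
    have := affine_nonneg_of_mem_convexHull (-f) (s := t.vertices) (by
      rintro _ ⟨j, rfl⟩
      simp only [AffineMap.coe_neg, Pi.neg_apply, hf]
      split_ifs <;> norm_num) hv
    simpa using this
  have hF0 : ∀ v ∈ convexHull ℝ F, f v = 0 := fun v hv =>
    convexHull_min (t := f ⁻¹' {0}) (fun w hw => by
      obtain ⟨i, rfl⟩ := hF hw
      simp [hf, hw]) ((convex_singleton 0).affine_preimage f) hv
  refine convexHull_mono (t := s ∩ convexHull ℝ F) (fun v hv => ⟨hv.1, ?_⟩)
    (mem_convexHull_inter_zero f (fun v hv => hle v (hs hv)) hz (hF0 z hzF).ge)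
  have hv' := mem_convexHull_inter_zero f (s := t.vertices)
    (fun w hw => hle w (subset_convexHull ℝ _ hw)) (hs hv.1) (le_of_eq hv.2.symm)
  refine convexHull_mono ?_ hv'
  rintro _ ⟨⟨i, rfl⟩, hi⟩
  by_contra hn
  simp [hf, hn] at hi

/-- The intersection of two simplices is the simplex spanned by the common vertices. -/
def Conf (t t' : TaggedSimplex V d) : Prop :=
  t.region ∩ t'.region = convexHull ℝ (t.vertices ∩ t'.vertices)

theorem conf_of_subset {t t' : TaggedSimplex V d}
    (h : t.region ∩ t'.region ⊆ convexHull ℝ (t.vertices ∩ t'.vertices)) : Conf t t' :=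
  h.antisymm (Set.subset_inter (convexHull_mono Set.inter_subset_left)
    (convexHull_mono Set.inter_subset_right))

theorem Conf.symm {t t' : TaggedSimplex V d} (h : Conf t t') : Conf t' t := by
  rw [Conf, Set.inter_comm, h, Set.inter_comm]

theorem Nondeg.mem_vertices_of_mem_region {t t' : TaggedSimplex V d} (h : t.Nondeg)
    (hc : Conf t t') {v : V} (hv : v ∈ t.vertices) (hv' : v ∈ t'.region) : v ∈ t'.vertices := by
  have : v ∈ convexHull ℝ (t.vertices ∩ t'.vertices) := hc ▸ ⟨subset_convexHull ℝ _ hv, hv'⟩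
  exact (h.mem_of_mem_convexHull hv Set.inter_subset_left this).2

/-- The only vertex missing in the first child is `x_d`. If it belongs to `s`, then `x₀` does not,
so `s` lies on the far side of the bisecting hyperplane and the child on the near side. The common
point is on the hyperplane, and `x_d` is not needed to span it. -/
theorem Nondeg.mem_convexHull_inter_firstChild {t : TaggedSimplex V d} (hd : 0 < d) (h : t.Nondeg)
    {s : Set V} (hs : s ⊆ t.vertices) (he : ¬ t.refinementEdge ⊆ s) {z : V}
    (hz : z ∈ convexHull ℝ s) (hzt : z ∈ t.firstChild.region) :
    z ∈ convexHull ℝ (s ∩ t.firstChild.vertices) := by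
  by_cases hl : t.vert (Fin.last d) ∈ s
  · have h0 : t.vert 0 ∉ s := fun h0 => he (by rintro v (rfl | rfl) <;> assumption)
    obtain ⟨c, hc⟩ := h (fun i => if i = 0 then 1 else if i = Fin.last d then -1 else 0)
    have hld : Fin.last d ≠ 0 := fun h0 => h.zero_ne_last hd (by rw [h0])
    have hnn : 0 ≤ c z := affine_nonneg_of_mem_convexHull c (fun v hv => by
      rcases (mem_firstChild_vertices hd).1 hv with rfl | ⟨j, hj, rfl⟩
      · rw [map_mid, hc, hc]
        simp [hld]
      · rw [hc, if_neg hj]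
        split_ifs <;> norm_num) hzt
    have := mem_convexHull_inter_zero c (fun v hv => by
      obtain ⟨j, rfl⟩ := hs hv
      have hj : j ≠ 0 := by
        rintro rfl
        exact h0 hv
      rw [hc, if_neg hj]
      split_ifs <;> norm_num) hz hnn
    refine convexHull_mono (s := s ∩ {v | c v = 0}) ?_ this
    rintro v ⟨hv, hv0⟩
    refine ⟨hv, mem_firstChild_of_ne hd (hs hv) ?_⟩
    rintro rfl
    rw [Set.mem_ofPred_eq, hc, if_neg hld, if_pos rfl] at hv0
    norm_num at hv0
  · refine convexHull_mono (t := s ∩ t.firstChild.vertices)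
      (fun v hv => ⟨hv, mem_firstChild_of_ne hd (hs hv) ?_⟩) hz
    rintro rfl
    exact hl hv

/-- If the common face contains a refinement edge, then the edge is common to both simplices, and
both are cut at the same midpoint. Otherwise the face contains neither edge, and each bisection
merely passes to a subface. -/
theorem Conf.firstChild {t t' : TaggedSimplex V d} (hd : 0 < d) (h : t.Nondeg) (h' : t'.Nondeg)
    (hc : Conf t t') (he : EdgeCompat t t') (he' : EdgeCompat t' t) :
    Conf t.firstChild t'.firstChild := by
  refine conf_of_subset ?_
  rintro z ⟨hz, hz'⟩
  have hzG : z ∈ convexHull ℝ (t.vertices ∩ t'.vertices) :=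
    hc ▸ ⟨firstChild_region_subset hd t hz, firstChild_region_subset hd t' hz'⟩
  by_cases hE : t.refinementEdge ⊆ t'.vertices
  · have heq := he hE
    have hmid : t.mid = t'.mid := by
      have := heq
      simp only [refinementEdge, Set.pair_eq_pair_iff] at this
      rcases this with ⟨h0, h1⟩ | ⟨h0, h1⟩
      · rw [mid, mid, h0, h1]
      · rw [mid, mid, h0, h1, midpoint_comm]
    have hld : Fin.last d ≠ 0 := fun h0 => h.zero_ne_last hd (by rw [h0])
    obtain ⟨c, hcv⟩ := h (fun i => if i = 0 then 1 else if i = Fin.last d then -1 else 0)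
    have hc0 : c (t.vert 0) = 1 := by simp [hcv]
    have hcl : c (t.vert (Fin.last d)) = -1 := by simp [hcv, hld]
    set G₀ := (t.vertices ∩ t'.vertices) \ t.refinementEdge with hG₀
    have hcG : ∀ v ∈ G₀, c v = 0 := by
      rintro _ ⟨⟨⟨j, rfl⟩, -⟩, hj⟩
      rw [hcv, if_neg, if_neg]
      · rintro rfl
        exact hj (Or.inr rfl)
      · rintro rfl
        exact hj (Or.inl rfl)
    have hnn : 0 ≤ c z := affine_nonneg_of_mem_convexHull c (fun v hv => by
      rcases (mem_firstChild_vertices hd).1 hv with rfl | ⟨j, hj, rfl⟩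
      · rw [map_mid, hc0, hcl]
        norm_num
      · rw [hcv, if_neg hj]
        split_ifs <;> norm_num) hz
    have hzb : z ∈ convexHull ℝ (insert (t.vert 0) (insert t.mid G₀)) := by
      refine mem_convexHull_bisect c hc0 hcl hcG (convexHull_mono ?_ hzG) hnn
      intro v hv
      by_cases hvE : v ∈ t.refinementEdge
      · rcases hvE with rfl | rfl
        · exact Or.inl rfl
        · exact Or.inr (Or.inl rfl)
      · exact Or.inr (Or.inr ⟨hv, hvE⟩)
    have hmm : t.mid ∈ t.firstChild.vertices ∩ t'.firstChild.vertices :=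
      ⟨(mem_firstChild_vertices hd).2 (Or.inl rfl),
        (mem_firstChild_vertices hd).2 (Or.inl hmid)⟩
    have hGm : G₀ ⊆ t.firstChild.vertices ∩ t'.firstChild.vertices := by
      rintro v ⟨⟨hv, hv'⟩, hvE⟩
      refine ⟨mem_firstChild_of_ne hd hv ?_, mem_firstChild_of_ne hd hv' ?_⟩
      · rintro rfl
        exact hvE (Or.inr rfl)
      · rintro rfl
        rw [heq] at hvE
        exact hvE (Or.inr rfl)
    have hpair := heq
    simp only [refinementEdge, Set.pair_eq_pair_iff] at hpair
    rcases hpair with ⟨h0, h1⟩ | ⟨h0, h1⟩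
    · refine convexHull_mono ?_ hzb
      rintro v (rfl | rfl | hv)
      · exact ⟨⟨0, rfl⟩, ⟨0, h0.symm⟩⟩
      · exact hmm
      · exact hGm hv
    -- The edges are oppositely oriented, so the two children lie on different sides of the cut.
    -- Their common points lie on the cut, which is spanned by the midpoint and `G₀`.
    · obtain ⟨c', hcv'⟩ := h' (fun i => if i = 0 then 1 else if i = Fin.last d then -1 else 0)
      have hc0' : c' (t'.vert 0) = 1 := by simp [hcv']
      have hcl' : c' (t'.vert (Fin.last d)) = -1 := by simp [hcv', hld]
      have hcm' : c' t.mid = 0 := by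
        rw [hmid, map_mid, hc0', hcl']
        norm_num
      have hcG' : ∀ v ∈ G₀, c' v = 0 := by
        rintro _ ⟨⟨-, ⟨j, rfl⟩⟩, hj⟩
        rw [heq] at hj
        rw [hcv', if_neg, if_neg]
        · rintro rfl
          exact hj (Or.inr rfl)
        · rintro rfl
          exact hj (Or.inl rfl)
      have hnp : 0 ≤ c' z := affine_nonneg_of_mem_convexHull c' (fun v hv => by
        rcases (mem_firstChild_vertices hd).1 hv with rfl | ⟨j, hj, rfl⟩
        · rw [← hmid, hcm']
        · rw [hcv', if_neg hj]
          split_ifs <;> norm_num) hz'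
      have hz0 := mem_convexHull_inter_zero c' (fun v hv => by
        rcases hv with rfl | rfl | hv
        · rw [h0, hcl']
          norm_num
        · exact hcm'.le
        · exact (hcG' v hv).le) hzb hnp
      refine convexHull_mono ?_ hz0
      rintro v ⟨rfl | rfl | hv, hv0⟩
      · rw [Set.mem_ofPred_eq, h0, hcl'] at hv0
        norm_num at hv0
      · exact hmm
      · exact hGm hv
  · have hE' : ¬ t'.refinementEdge ⊆ t.vertices := fun hE' => by
      have := he' hE'
      exact hE (this ▸ t'.refinementEdge_subset)
    have h1 := h.mem_convexHull_inter_firstChild hd Set.inter_subset_left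
      (fun hs => hE (hs.trans Set.inter_subset_right)) hzG hz
    have h2 := h'.mem_convexHull_inter_firstChild hd
      (Set.inter_subset_left.trans Set.inter_subset_right)
      (fun hs => hE' (hs.trans (Set.inter_subset_left.trans Set.inter_subset_left))) h1 hz'
    refine convexHull_mono ?_ h2
    rintro v ⟨⟨-, hv⟩, hv'⟩
    exact ⟨hv, hv'⟩

end TaggedSimplex

namespace TaggedSimplex

/-! ### Compatibility of the labels of two simplices -/

section Labels

variable {V : Type*} {d : ℕ}

/-- The positions of the vertices that are not among the `γ` newest ones. -/
def IsOldIdx (γ : ℕ) (i : Fin (d + 1)) : Prop := i.val = 0 ∨ γ < i.val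

/-- The position along the path `x₀, x_{γ+1}, …, x_d`, shifted by `γ`. -/
def pathPos (γ : ℕ) (i : Fin (d + 1)) : ℤ := max (i.val : ℤ) γ

/-- On the common vertices that lie in `F`, the labels of `t` and `t'` agree: the newest vertices
have the same positions, and the others keep their distances along the path. -/
structure PosCompatOn (F : Set V) (t t' : TaggedSimplex V d) : Prop where
  type_eq : t.type = t'.type
  newest : ∀ i j, t.vert i = t'.vert j → t.vert i ∈ F →
    (¬ IsOldIdx t.type i ∨ ¬ IsOldIdx t.type j) → i = j
  path : ∀ i j k l, t.vert i = t'.vert j → t.vert i ∈ F → t.vert k = t'.vert l → t.vert k ∈ F →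
    IsOldIdx t.type i → IsOldIdx t.type j → IsOldIdx t.type k → IsOldIdx t.type l →
    |pathPos t.type i - pathPos t.type k| = |pathPos t.type j - pathPos t.type l|

theorem PosCompatOn.mono {F G : Set V} {t t' : TaggedSimplex V d} (h : PosCompatOn F t t')
    (hG : G ⊆ F) : PosCompatOn G t t' :=
  ⟨h.type_eq, fun i j e m => h.newest i j e (hG m),
    fun i j k l e m e' m' => h.path i j k l e (hG m) e' (hG m')⟩

theorem PosCompatOn.symm {F : Set V} {t t' : TaggedSimplex V d} (h : PosCompatOn F t t') :
    PosCompatOn F t' t := by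
  refine ⟨h.type_eq.symm, fun i j e m o => ?_, fun i j k l e m e' m' oi oj ok ol => ?_⟩
  · rw [← h.type_eq] at o
    exact (h.newest j i e.symm (e ▸ m) o.symm).symm
  · rw [← h.type_eq] at oi oj ok ol ⊢
    exact (h.path j i l k e.symm (e ▸ m) e'.symm (e' ▸ m') oj oi ol ok).symm

/-- Compatibility is not transitive on all common vertices, since a vertex common to the outer
simplices may be missing in the middle one. Restricting to a set `F` of vertices of the middle
simplex repairs this. -/
theorem PosCompatOn.trans {F : Set V} {t t' t'' : TaggedSimplex V d} (h : PosCompatOn F t t')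
    (h' : PosCompatOn F t' t'') (hF : F ⊆ t'.vertices) : PosCompatOn F t t'' := by
  have hn := h'.newest
  have hp := h'.path
  rw [← h.type_eq] at hn hp
  refine ⟨h.type_eq.trans h'.type_eq, fun i j e m o => ?_,
    fun i j k l e m e' m' oi oj ok ol => ?_⟩
  · obtain ⟨a, ha⟩ := hF m
    rcases o with o | o
    · obtain rfl := h.newest i a ha.symm m (Or.inl o)
      exact hn i j (ha.trans e) (ha ▸ m) (Or.inl o)
    · obtain rfl := hn a j (ha.trans e) (ha ▸ m) (Or.inr o)
      exact h.newest i a ha.symm m (Or.inr o)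
  · obtain ⟨a, ha⟩ := hF m
    obtain ⟨b, hb⟩ := hF m'
    have oa : IsOldIdx t.type a := by
      by_contra o
      exact o (h.newest i a ha.symm m (Or.inr o) ▸ oi)
    have ob : IsOldIdx t.type b := by
      by_contra o
      exact o (h.newest k b hb.symm m' (Or.inr o) ▸ ok)
    rw [h.path i a k b ha.symm m hb.symm m' oi oa ok ob,
      hp a j b l (ha.trans e) (ha ▸ m) (hb.trans e') (hb ▸ m') oa oj ob ol]

theorem PosCompatOn.refl {t : TaggedSimplex V d} (h : Function.Injective t.vert) (F : Set V) :
    PosCompatOn F t t := by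
  refine ⟨rfl, fun i j e _ _ => h e, fun i j k l e _ e' _ _ _ _ _ => ?_⟩
  rw [h e, h e']

theorem posCompatOn_of_aligned {t t' : TaggedSimplex V d} (ht : t.type = t'.type)
    (h : ∀ i j, t.vert i = t'.vert j → i = j) (F : Set V) : PosCompatOn F t t' := by
  refine ⟨ht, fun i j e _ _ => h i j e, fun i j k l e _ e' _ _ _ _ _ => ?_⟩
  rw [h i j e, h k l e']

theorem reflectIdx_of_not_isOldIdx {γ : ℕ} (hγ : γ < d) {i : Fin (d + 1)}
    (hi : ¬ IsOldIdx γ i) : reflectIdx d γ i = i := by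
  simp only [IsOldIdx, not_or, not_lt] at hi
  unfold reflectIdx
  rw [if_neg (by simp only [Fin.ext_iff, Fin.val_zero]; omega),
    if_neg (by simp only [Fin.ext_iff, Fin.val_last]; omega), dif_neg (by omega)]

/-- Reflection runs through the path of old vertices backwards. Hence distances along the path,
unlike positions, do not depend on which of the two orderings is used. -/
theorem pathPos_reflectIdx {γ : ℕ} (hγ : γ < d) {i : Fin (d + 1)} (hi : IsOldIdx γ i) :
    IsOldIdx γ (reflectIdx d γ i) ∧ pathPos γ (reflectIdx d γ i) = d + γ - pathPos γ i := by
  have hi' := i.isLt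
  unfold IsOldIdx at hi
  unfold IsOldIdx pathPos reflectIdx
  by_cases h0 : i = 0
  · subst h0
    simp only [if_true, Fin.val_last, Fin.val_zero]
    constructor
    · omega
    · simp only [Nat.cast_zero]
      omega
  have h0' : i.val ≠ 0 := fun h => h0 (Fin.ext h)
  rw [if_neg h0]
  by_cases hl : i = Fin.last d
  · subst hl
    rw [if_pos rfl]
    refine ⟨Or.inl rfl, ?_⟩
    simp only [Fin.val_last, Fin.val_zero, Nat.cast_zero]
    omega
  have hl' : i.val ≠ d := fun h => hl (Fin.ext h)
  rw [if_neg hl, dif_pos (by omega)]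
  simp only
  constructor <;> omega

theorem PosCompatOn.reflect_left {F : Set V} {t t' : TaggedSimplex V d} (h : PosCompatOn F t t')
    (hγ : t.type < d) : PosCompatOn F t.reflect t' := by
  refine ⟨h.type_eq, fun i j e m o => ?_, fun i j k l e m e' m' oi oj ok ol => ?_⟩
  · have hr := reflectIdx_involutive d t.type i
    rcases o with o | o
    · have hi := reflectIdx_of_not_isOldIdx hγ o
      rw [← h.newest (reflectIdx d t.type i) j e m (Or.inl (by rwa [hi])), hi]
    · have hi := h.newest (reflectIdx d t.type i) j e m (Or.inr o)
      rw [hi] at hr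
      rw [← hr]
      exact reflectIdx_of_not_isOldIdx hγ o
  · have hi := pathPos_reflectIdx hγ oi
    have hk := pathPos_reflectIdx hγ ok
    rw [reflect_type] at oi oj ok ol ⊢
    rw [← h.path _ j _ l e m e' m' hi.1 oj hk.1 ol, hi.2, hk.2, abs_sub_comm]
    congr 1
    ring

theorem PosCompatOn.reflect_right {F : Set V} {t t' : TaggedSimplex V d} (h : PosCompatOn F t t')
    (hγ : t.type < d) : PosCompatOn F t t'.reflect :=
  (h.symm.reflect_left (h.type_eq ▸ hγ)).symm

theorem edgeCompat_of_aligned {t t' : TaggedSimplex V d}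
    (h : ∀ i j, t.vert i = t'.vert j → i = j) : EdgeCompat t t' := by
  intro he
  obtain ⟨j, hj⟩ := he (Or.inl rfl)
  obtain ⟨l, hl⟩ := he (Or.inr rfl)
  rw [refinementEdge, refinementEdge, ← hj, ← hl, ← h _ _ hj.symm, ← h _ _ hl.symm]

/-- The refinement edge joins the two ends of the path, at the maximal distance `d - γ`. Two old
vertices at this distance in the other simplex must be the ends of its path. -/
theorem PosCompatOn.edgeCompat {t t' : TaggedSimplex V d} (h : PosCompatOn Set.univ t t')
    (hγ : t.type < d) : EdgeCompat t t' := by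
  intro he
  obtain ⟨j, hj⟩ := he (Or.inl rfl)
  obtain ⟨l, hl⟩ := he (Or.inr rfl)
  have o0 : IsOldIdx t.type (0 : Fin (d + 1)) := Or.inl rfl
  have od : IsOldIdx t.type (Fin.last d) := Or.inr hγ
  have oj : IsOldIdx t.type j := by
    by_contra o
    exact o (h.newest _ j hj.symm trivial (Or.inr o) ▸ o0)
  have ol : IsOldIdx t.type l := by
    by_contra o
    exact o (h.newest _ l hl.symm trivial (Or.inr o) ▸ od)
  have hp := h.path _ j _ l hj.symm trivial hl.symm trivial o0 oj od ol
  have hj' := j.isLt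
  have hl' := l.isLt
  simp only [pathPos, Fin.val_zero, Fin.val_last, IsOldIdx, Nat.cast_zero] at hp oj ol
  have hlt : (t.type : ℤ) < d := by exact_mod_cast hγ
  rw [max_eq_right (by omega), max_eq_left (by omega), abs_of_neg (by omega)] at hp
  have : (j.val = 0 ∧ l.val = d) ∨ (j.val = d ∧ l.val = 0) := by
    rcases abs_cases (max (j.val : ℤ) t.type - max (l.val : ℤ) t.type) with ⟨ha, -⟩ | ⟨ha, -⟩ <;>
    omega
  rcases this with ⟨h0, h1⟩ | ⟨h0, h1⟩
  · obtain rfl : j = 0 := Fin.ext h0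
    obtain rfl : l = Fin.last d := Fin.ext h1
    rw [refinementEdge, refinementEdge, hj, hl]
  · obtain rfl : j = Fin.last d := Fin.ext h0
    obtain rfl : l = 0 := Fin.ext h1
    rw [refinementEdge, refinementEdge, hj, hl, Set.pair_comm]

/-- The invariant of the uniform refinement: the types agree, and so do the positions of the common
vertices; in two dimensions only the refinement edges matter. -/
structure LabelCompat (t t' : TaggedSimplex V d) : Prop where
  type_eq : t.type = t'.type
  type_lt : t.type < d
  edge : d = 2 → EdgeCompat t t' ∧ EdgeCompat t' t
  pos : d ≠ 2 → PosCompatOn Set.univ t t'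

theorem LabelCompat.symm {t t' : TaggedSimplex V d} (h : LabelCompat t t') : LabelCompat t' t :=
  ⟨h.type_eq.symm, h.type_eq ▸ h.type_lt, fun hd => (h.edge hd).symm, fun hd => (h.pos hd).symm⟩

theorem LabelCompat.reflect_left {t t' : TaggedSimplex V d} (h : LabelCompat t t') :
    LabelCompat t.reflect t' := by
  refine ⟨h.type_eq, h.type_lt, fun hd => ?_, fun hd => (h.pos hd).reflect_left h.type_lt⟩
  simpa [EdgeCompat] using h.edge hd

theorem LabelCompat.ite_reflect {t t' : TaggedSimplex V d} (h : LabelCompat t t') (b b' : Bool) :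
    LabelCompat (if b then t.reflect else t) (if b' then t'.reflect else t') := by
  have h1 : LabelCompat (if b then t.reflect else t) t' := by
    cases b
    · exact h
    · exact h.reflect_left
  cases b'
  · exact h1
  · exact h1.symm.reflect_left.symm

theorem LabelCompat.edgeCompat {t t' : TaggedSimplex V d} (h : LabelCompat t t') :
    EdgeCompat t t' := by
  by_cases hd : d = 2
  · exact (h.edge hd).1
  · exact (h.pos hd).edgeCompat h.type_lt

theorem LabelCompat.of_aligned {t t' : TaggedSimplex V d} (ht : t.type = t'.type)
    (hγ : t.type < d) (h : ∀ i j, t.vert i = t'.vert j → i = j) : LabelCompat t t' :=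
  ⟨ht, hγ, fun _ => ⟨edgeCompat_of_aligned h,
    edgeCompat_of_aligned fun i j e => (h j i e.symm).symm⟩, fun _ => posCompatOn_of_aligned ht h _⟩

theorem aligned_of_existsUnique {t t' : TaggedSimplex V d} (h : Function.Injective t.vert)
    (h' : Function.Injective t'.vert) (hk : ∃! k, t.vert k ≠ t'.vert k) (i j : Fin (d + 1))
    (e : t.vert i = t'.vert j) : i = j := by
  obtain ⟨k, -, hu⟩ := hk
  have heq : ∀ l, l ≠ k → t.vert l = t'.vert l := fun l hl => by
    by_contra hne
    exact hl (hu l hne)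
  by_cases hi : i = k
  · by_cases hj : j = k
    · rw [hi, hj]
    · exact h (e.trans (heq j hj).symm)
  · exact h' ((heq i hi).symm.trans e)

theorem reflect_injective {t : TaggedSimplex V d} (h : Function.Injective t.vert) :
    Function.Injective t.reflect.vert :=
  h.comp (reflectIdx_involutive d t.type).injective

theorem ReflectedNeighbours.labelCompat {t t' : TaggedSimplex V d}
    (h : Function.Injective t.vert) (h' : Function.Injective t'.vert) (hγ : t.type < d)
    (hn : ReflectedNeighbours t t') : LabelCompat t t' := by
  obtain ⟨ht, hn | hn⟩ := hn
  · exact .of_aligned ht hγ (aligned_of_existsUnique h h' hn)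
  · have : LabelCompat t.reflect t' :=
      .of_aligned ht hγ (aligned_of_existsUnique (reflect_injective h) h' hn)
    simpa using this.reflect_left

theorem ite_reflect_vertices (t : TaggedSimplex V d) (b : Bool) :
    (if b then t.reflect else t).vertices = t.vertices := by
  cases b
  · rfl
  · exact reflect_vertices t

/-- The position in the parent of the vertex at the position `i ≠ 1` of the first child. -/
def parentIdx (i : Fin (d + 1)) : Fin (d + 1) := ⟨i.val - 1, by omega⟩

/-- The position in the first child of the vertex at the position `i ≠ d` of the parent. -/
def childIdx (i : Fin (d + 1)) (hi : i.val ≠ d) : Fin (d + 1) :=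
  if i.val = 0 then 0 else ⟨i.val + 1, by omega⟩

theorem childIdx_val (i : Fin (d + 1)) (hi : i.val ≠ d) :
    (childIdx i hi).val = if i.val = 0 then 0 else i.val + 1 := by
  unfold childIdx
  split_ifs <;> rfl

theorem childIdx_inj {i j : Fin (d + 1)} {hi : i.val ≠ d} {hj : j.val ≠ d}
    (h : childIdx i hi = childIdx j hj) : i = j := by
  have := congrArg Fin.val h
  rw [childIdx_val, childIdx_val] at this
  apply Fin.ext
  split_ifs at this <;> omega

end Labels

/-! ### Bisection keeps the labels compatible -/

variable {V : Type*} {d : ℕ} [AddCommGroup V] [Module ℝ V]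

theorem firstChild_vert_parentIdx (t : TaggedSimplex V d) {i : Fin (d + 1)} (hi : i.val ≠ 1) :
    t.firstChild.vert i = t.vert (parentIdx i) := by
  by_cases h0 : i.val = 0
  · obtain rfl : i = 0 := Fin.ext h0
    rfl
  · exact firstChild_vert_of_one_lt t (by omega) (by simp only [parentIdx]; omega)

theorem firstChild_vert_childIdx (t : TaggedSimplex V d) {i : Fin (d + 1)} (hi : i.val ≠ d) :
    t.firstChild.vert (childIdx i hi) = t.vert i := by
  unfold childIdx
  split_ifs with h0
  · obtain rfl : i = 0 := Fin.ext h0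
    rfl
  · exact firstChild_vert_of_one_lt t (by simp only; omega) rfl

theorem eq_or_parent_of_firstChild_eq {t t' : TaggedSimplex V d} (hm : t.mid ∉ t'.vertices)
    (hm' : t'.mid ∉ t.vertices) {i j : Fin (d + 1)}
    (e : t.firstChild.vert i = t'.firstChild.vert j) :
    (i.val = 1 ∧ j.val = 1) ∨
      (i.val ≠ 1 ∧ j.val ≠ 1 ∧ t.vert (parentIdx i) = t'.vert (parentIdx j)) := by
  by_cases hi : i.val = 1
  · by_cases hj : j.val = 1
    · exact Or.inl ⟨hi, hj⟩
    · rw [firstChild_vert_one t hi, firstChild_vert_parentIdx t' hj] at e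
      exact absurd ⟨_, e.symm⟩ hm
  · by_cases hj : j.val = 1
    · rw [firstChild_vert_one t' hj, firstChild_vert_parentIdx t hi] at e
      exact absurd ⟨_, e⟩ hm'
    · rw [firstChild_vert_parentIdx t hi, firstChild_vert_parentIdx t' hj] at e
      exact Or.inr ⟨hi, hj, e⟩

/-- The midpoint becomes the newest vertex, at position 1 in both children; the earlier newest
vertices and the rest of the path beyond `x₀` move up by one. When `γ + 1 = d`, the type returns to
0 and all vertices count as old again, but then all common vertices of the children already have
equal positions. -/
theorem PosCompatOn.firstChild {t t' : TaggedSimplex V d} (h : PosCompatOn Set.univ t t')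
    (hγ : t.type < d) (hm : t.mid ∉ t'.vertices) (hm' : t'.mid ∉ t.vertices) :
    PosCompatOn Set.univ t.firstChild t'.firstChild := by
  have hnew : ∀ i j : Fin (d + 1), t.firstChild.vert i = t'.firstChild.vert j →
      ((1 ≤ i.val ∧ i.val ≤ t.type + 1) ∨ (1 ≤ j.val ∧ j.val ≤ t.type + 1)) → i = j := by
    intro i j e o
    rcases eq_or_parent_of_firstChild_eq hm hm' e with ⟨hi, hj⟩ | ⟨hi, hj, e⟩
    · exact Fin.ext (hi.trans hj.symm)
    · have := h.newest _ _ e trivial (by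
        simp only [IsOldIdx, parentIdx]
        omega)
      simp only [parentIdx, Fin.mk.injEq] at this
      apply Fin.ext
      omega
  refine ⟨by simp [h.type_eq], fun i j e _ o => ?_, fun i j k l e _ e' _ oi oj ok ol => ?_⟩
  · rw [firstChild_type] at o
    refine hnew i j e ?_
    simp only [IsOldIdx] at o
    have := Nat.mod_le (t.type + 1) d
    omega
  · rw [firstChild_type] at oi oj ok ol ⊢
    rcases Nat.lt_or_ge (t.type + 1) d with hlt | hge
    · rw [Nat.mod_eq_of_lt hlt] at oi oj ok ol ⊢
      have key : ∀ i : Fin (d + 1), IsOldIdx (t.type + 1) i → i.val ≠ 1 ∧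
          IsOldIdx t.type (parentIdx i) ∧
          pathPos (t.type + 1) i = pathPos t.type (parentIdx i) + 1 := fun i hi => by
        simp only [IsOldIdx, pathPos, parentIdx] at hi ⊢
        omega
      obtain ⟨ni, oi, pi⟩ := key i oi
      obtain ⟨nj, oj, pj⟩ := key j oj
      obtain ⟨nk, ok, pk⟩ := key k ok
      obtain ⟨nl, ol, pl⟩ := key l ol
      rw [firstChild_vert_parentIdx t ni, firstChild_vert_parentIdx t' nj] at e
      rw [firstChild_vert_parentIdx t nk, firstChild_vert_parentIdx t' nl] at e'
      have := h.path _ _ _ _ e trivial e' trivial oi oj ok ol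
      rw [pi, pj, pk, pl]
      simpa using this
    · have key : ∀ i j : Fin (d + 1), t.firstChild.vert i = t'.firstChild.vert j → i = j := by
        intro i j e
        by_cases h0 : i.val = 0 ∧ j.val = 0
        · exact Fin.ext (h0.1.trans h0.2.symm)
        · exact hnew i j e (by omega)
      rw [key i j e, key k l e']

/-- In a triangle the refinement edge of the child is opposite to the new midpoint. A copy of it in
the other child avoids that child's midpoint, which is no vertex of `t`, so it is the edge opposite
to it. -/
theorem EdgeCompat.firstChild_of_two {t t' : TaggedSimplex V d} (hd : d = 2) (h : t.Nondeg)
    (hm' : t'.mid ∉ t.vertices) : EdgeCompat t.firstChild t'.firstChild := by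
  subst hd
  have hl : ∀ t : TaggedSimplex V 2, t.firstChild.vert (Fin.last 2) = t.vert 1 := fun t => rfl
  have hne : t.vert 0 ≠ t.vert 1 := fun h' => by
    have := h.injective h'
    simp at this
  have key : ∀ i : Fin 3, t.vert i ∈ t'.firstChild.vertices →
      t.vert i = t'.vert 0 ∨ t.vert i = t'.vert 1 := by
    rintro i ⟨j, hj⟩
    by_cases h1 : j.val = 1
    · rw [firstChild_vert_one t' h1] at hj
      exact absurd ⟨i, hj.symm⟩ hm'
    · rw [firstChild_vert_parentIdx t' h1] at hj
      fin_cases j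
      · exact Or.inl hj.symm
      · simp at h1
      · exact Or.inr hj.symm
  intro he
  simp only [refinementEdge, firstChild_vert_zero, hl] at he ⊢
  have h0 := key 0 (he (Or.inl rfl))
  have h1 := key 1 (he (Or.inr rfl))
  rw [Set.pair_eq_pair_iff]
  rcases h0 with h0 | h0 <;> rcases h1 with h1 | h1
  · exact absurd (h0.trans h1.symm) hne
  · exact Or.inl ⟨h0, h1⟩
  · exact Or.inr ⟨h0, h1⟩
  · exact absurd (h0.trans h1.symm) hne

/-- Otherwise the midpoint would be a vertex of `t'` inside `t`, hence by conformity a vertex of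
`t`. -/
theorem Nondeg.mid_notMem_of_conf {t t' : TaggedSimplex V d} (hd : 0 < d) (h : t.Nondeg)
    (h' : t'.Nondeg) (hc : Conf t t') : t.mid ∉ t'.vertices := fun hm =>
  h.mid_notMem hd (h'.mem_vertices_of_mem_region hc.symm hm t.mid_mem_region)

theorem LabelCompat.firstChild {t t' : TaggedSimplex V d} (hd : 0 < d) (hl : LabelCompat t t')
    (h : t.Nondeg) (h' : t'.Nondeg) (hc : Conf t t') :
    LabelCompat t.firstChild t'.firstChild := by
  have hm := h.mid_notMem_of_conf hd h' hc
  have hm' := h'.mid_notMem_of_conf hd h hc.symm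
  exact ⟨by simp [hl.type_eq], Nat.mod_lt _ hd,
    fun h2 => ⟨.firstChild_of_two h2 h hm', .firstChild_of_two h2 h' hm⟩,
    fun h2 => (hl.pos h2).firstChild hl.type_lt hm hm'⟩

theorem Nondeg.ite_reflect {t : TaggedSimplex V d} (h : t.Nondeg) (b : Bool) :
    (if b then t.reflect else t).Nondeg := by
  cases b
  · exact h
  · exact h.reflect

theorem Conf.ite_reflect {t t' : TaggedSimplex V d} (hc : Conf t t') (b b' : Bool) :
    Conf (if b then t.reflect else t) (if b' then t'.reflect else t') := by
  simpa only [Conf, region, ite_reflect_vertices] using hc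

theorem Conf.child {t t' : TaggedSimplex V d} (hd : 0 < d) (h : t.Nondeg) (h' : t'.Nondeg)
    (hc : Conf t t') (hl : LabelCompat t t') (b b' : Bool) :
    Conf (t.child b) (t'.child b') ∧ LabelCompat (t.child b) (t'.child b') := by
  rw [child_eq_firstChild, child_eq_firstChild]
  have hl' := hl.ite_reflect b b'
  have hc' := hc.ite_reflect b b'
  exact ⟨hc'.firstChild hd (h.ite_reflect b) (h'.ite_reflect b') hl'.edgeCompat
    hl'.symm.edgeCompat, hl'.firstChild hd (h.ite_reflect b) (h'.ite_reflect b') hc'⟩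

/-! ### Matching neighbours -/

/-- Since neither last vertex is shared, all common vertices survive in the first children. As `γ +
1 < d`, the type does not wrap around, and the shift of positions can be undone. -/
theorem PosCompatOn.of_firstChild {t t' : TaggedSimplex V d} (ht : t.type = t'.type)
    (hγ : t.type + 1 < d) (hl : t.vert (Fin.last d) ∉ t'.vertices)
    (hl' : t'.vert (Fin.last d) ∉ t.vertices)
    (h : PosCompatOn Set.univ t.firstChild t'.firstChild) : PosCompatOn Set.univ t t' := by
  have hne : ∀ i j, t.vert i = t'.vert j → i.val ≠ d ∧ j.val ≠ d := by
    refine fun i j e => ⟨fun hi => hl ?_, fun hj => hl' ?_⟩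
    · obtain rfl : i = Fin.last d := Fin.ext hi
      exact ⟨j, e.symm⟩
    · obtain rfl : j = Fin.last d := Fin.ext hj
      exact ⟨i, e⟩
  have hn := h.newest
  have hp := h.path
  rw [firstChild_type, Nat.mod_eq_of_lt hγ] at hn hp
  refine ⟨ht, fun i j e _ o => ?_, fun i j k l e _ e' _ oi oj ok ol => ?_⟩
  · obtain ⟨ni, nj⟩ := hne i j e
    have := hn (childIdx i ni) (childIdx j nj)
      (by rw [firstChild_vert_childIdx, firstChild_vert_childIdx, e]) trivial (by
        have key : ∀ (i : Fin (d + 1)) (hi : i.val ≠ d), ¬ IsOldIdx t.type i →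
            ¬ IsOldIdx (t.type + 1) (childIdx i hi) := fun i hi o => by
          simp only [IsOldIdx, childIdx_val, not_or, not_lt] at o ⊢
          rw [if_neg o.1]
          omega
        exact o.imp (key i ni) (key j nj))
    exact childIdx_inj this
  · obtain ⟨ni, nj⟩ := hne i j e
    obtain ⟨nk, nl⟩ := hne k l e'
    have key : ∀ (i : Fin (d + 1)) (hi : i.val ≠ d), IsOldIdx t.type i →
        IsOldIdx (t.type + 1) (childIdx i hi) ∧
        pathPos (t.type + 1) (childIdx i hi) = pathPos t.type i + 1 := fun i hi o => by
      simp only [IsOldIdx, pathPos, childIdx_val] at o ⊢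
      split_ifs <;> constructor <;> omega
    obtain ⟨oi, pi⟩ := key i ni oi
    obtain ⟨oj, pj⟩ := key j nj oj
    obtain ⟨ok, pk⟩ := key k nk ok
    obtain ⟨ol, pl⟩ := key l nl ol
    have := hp _ _ _ _ (by rw [firstChild_vert_childIdx, firstChild_vert_childIdx, e]) trivial
      (by rw [firstChild_vert_childIdx, firstChild_vert_childIdx, e']) trivial oi oj ok ol
    rw [pi, pj, pk, pl] at this
    simpa using this

/-- If the children that contain the common face are reflected neighbours, then the labels of the
parents are compatible. -/
theorem posCompat_of_firstChild_reflectedNeighbours {t t' : TaggedSimplex V d} (hd : 0 < d)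
    (hd2 : d ≠ 2) (h : t.Nondeg) (h' : t'.Nondeg) (ht : t.type = t'.type) (hγ : t.type < d)
    (hcard : (t.vertices ∩ t'.vertices).ncard = d) (hl : t.vert (Fin.last d) ∉ t'.vertices)
    (hl' : t'.vert (Fin.last d) ∉ t.vertices)
    (hn : ReflectedNeighbours t.firstChild t'.firstChild) : PosCompatOn Set.univ t t' := by
  have hi := (h.firstChild hd).injective
  have hi' := (h'.firstChild hd).injective
  rcases Nat.lt_or_ge (t.type + 1) d with hlt | hge
  · exact .of_firstChild ht hlt hl hl'
      ((hn.labelCompat hi hi' (Nat.mod_lt _ hd)).pos hd2)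
  have hne : ∀ i j, t.vert i = t'.vert j → i.val ≠ d ∧ j.val ≠ d := by
    refine fun i j e => ⟨fun hi => hl ?_, fun hj => hl' ?_⟩
    · obtain rfl : i = Fin.last d := Fin.ext hi
      exact ⟨j, e.symm⟩
    · obtain rfl : j = Fin.last d := Fin.ext hj
      exact ⟨i, e⟩
  refine posCompatOn_of_aligned ht (fun i j e => ?_) _
  rcases hn.2 with hn | hn
  · obtain ⟨ni, nj⟩ := hne i j e
    exact childIdx_inj (aligned_of_existsUnique hi hi' hn (childIdx i ni) (childIdx j nj)
      (by rw [firstChild_vert_childIdx, firstChild_vert_childIdx, e]))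
  · obtain ⟨ni, nj⟩ := hne i j e
    -- For `d = 1` a common vertex can only have position 0 in both simplices. For `d ≥ 3` a match
    -- of the reflected child is impossible.
    rcases Nat.lt_or_ge d 3 with h3 | h3
    · apply Fin.ext
      omega
    exfalso
    have hS : t.vertices ∩ t'.vertices = t.vertices \ {t.vert (Fin.last d)} := by
      refine Set.eq_of_subset_of_ncard_le ?_ ?_ (Set.finite_range _).sdiff
      · rintro v ⟨hv, hv'⟩
        refine ⟨hv, ?_⟩
        rintro rfl
        exact hl hv'
      · rw [hcard, Set.ncard_sdiff_singleton_of_mem (show t.vert (Fin.last d) ∈ t.vertices from ⟨_, rfl⟩), vertices,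
          Set.ncard_range_of_injective h.injective, Nat.card_eq_fintype_card, Fintype.card_fin]
        omega
    -- The vertex at position `d - 2` is shared and moves to position `d - 1` in the child. The type
    -- of the child is 0, so reflection sends it to position 1, which the other child reserves for
    -- its midpoint.
    set a : Fin (d + 1) := ⟨d - 2, by omega⟩ with ha
    have haS : t.vert a ∈ t.vertices ∩ t'.vertices := by
      rw [hS]
      refine ⟨⟨a, rfl⟩, fun he => ?_⟩
      have := congrArg Fin.val (h.injective he)
      simp [ha] at this
      omega
    obtain ⟨c, hc⟩ := haS.2
    obtain ⟨na, nc⟩ := hne a c hc.symm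
    have hr : reflectIdx d t.firstChild.type (reflectIdx d t.firstChild.type (childIdx a na)) =
      childIdx a na := reflectIdx_involutive _ _ _
    have := aligned_of_existsUnique (reflect_injective hi) hi' hn
      (reflectIdx d t.firstChild.type (childIdx a na)) (childIdx c nc) (by
        rw [firstChild_vert_childIdx, hc, ← firstChild_vert_childIdx t na]
        simp only [reflect, Function.comp_apply, hr])
    have ha' : (childIdx a na).val = d - 1 := by
      rw [childIdx_val, ha]
      split_ifs <;> simp only at * <;> omega
    have hγ' : t.firstChild.type = 0 := by
      rw [firstChild_type, show t.type + 1 = d by omega, Nat.mod_self]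
    have h1 : (reflectIdx d t.firstChild.type (childIdx a na)).val = 1 := by
      rw [hγ']
      unfold reflectIdx
      rw [if_neg (by rw [Fin.ext_iff, ha', Fin.val_zero]; omega),
        if_neg (by rw [Fin.ext_iff, ha', Fin.val_last]; omega), dif_pos (by omega)]
      simp only [ha']
      omega
    rw [this] at h1
    rw [childIdx_val] at h1
    split_ifs at h1
    omega

theorem exists_inter_subset_child {t : TaggedSimplex V d} (hd : 0 < d) {S : Set V}
    (hS : S ⊆ t.vertices) (he : ¬ t.refinementEdge ⊆ S) :
    ∃ b : Bool, (if b then t.reflect else t).vert (Fin.last d) ∉ S ∧ S ⊆ (t.child b).vertices := by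
  by_cases hl : t.vert (Fin.last d) ∈ S
  · have h0 : t.vert 0 ∉ S := fun h0 => he (by rintro v (rfl | rfl) <;> assumption)
    refine ⟨true, by rwa [if_pos rfl, reflect_vert_last], fun v hv => ?_⟩
    refine mem_firstChild_of_ne hd (by simpa using hS hv) ?_
    rintro rfl
    rw [reflect_vert_last] at hv
    exact h0 hv
  · refine ⟨false, hl, fun v hv => mem_firstChild_of_ne hd (hS hv) ?_⟩
    rintro rfl
    exact hl hv

/-- If no refinement edge lies in the common face, compatibility of edges is vacuous, which is all
that `d = 2` requires. For `d ≠ 2`, compatibility of positions is pulled back from the children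
containing the face; each parent is first reflected if necessary, so that this child is its first
one. -/
theorem Match.labelCompat {t t' : TaggedSimplex V d} (hd : 0 < d) (h : t.Nondeg) (h' : t'.Nondeg)
    (ht : t.type = t'.type) (hγ : t.type < d) (hcard : (t.vertices ∩ t'.vertices).ncard = d)
    (hm : t.Match t') : LabelCompat t t' := by
  by_cases hE : t.refinementEdge ⊆ t.vertices ∩ t'.vertices ∨
      t'.refinementEdge ⊆ t.vertices ∩ t'.vertices
  · exact (hm.1 hE).labelCompat h.injective h'.injective hγ
  · have hE' := not_or.1 hE
    obtain ⟨b, hb, hbS⟩ := exists_inter_subset_child hd Set.inter_subset_left hE'.1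
    obtain ⟨b', hb', hbS'⟩ := exists_inter_subset_child hd Set.inter_subset_right hE'.2
    have hn := hm.2 hE b b' hbS hbS'
    refine ⟨ht, hγ, fun _ => ⟨fun he => ?_, fun he => ?_⟩, fun hd2 => ?_⟩
    · exact absurd (Set.subset_inter t.refinementEdge_subset he) hE'.1
    · exact absurd (Set.subset_inter he t'.refinementEdge_subset) hE'.2
    · rw [child_eq_firstChild, child_eq_firstChild] at hn
      have hv := ite_reflect_vertices t b
      have hv' := ite_reflect_vertices t' b'
      have htb : (if b then t.reflect else t).type = t.type := by cases b <;> rfl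
      have htb' : (if b' then t'.reflect else t').type = t'.type := by cases b' <;> rfl
      have hp := posCompat_of_firstChild_reflectedNeighbours hd hd2 (h.ite_reflect b)
        (h'.ite_reflect b') (by rw [htb, htb', ht]) (by rw [htb]; exact hγ)
        (by rw [hv, hv', hcard])
        (by
          rw [hv']
          exact fun hx => hb ⟨hv ▸ ⟨_, rfl⟩, hx⟩)
        (by
          rw [hv]
          exact fun hx => hb' ⟨hx, hv' ▸ ⟨_, rfl⟩⟩) hn
      have h1 : PosCompatOn Set.univ t (if b' then t'.reflect else t') := by
        cases b
        · exact hp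
        · have := PosCompatOn.reflect_left hp hγ
          simpa using this
      cases b'
      · exact h1
      · have := PosCompatOn.reflect_right h1 hγ
        simpa using this

end TaggedSimplex

section

namespace TaggedSimplex

/-! ### Affine maps and tagged simplices -/

section Map

variable {V W : Type*} {d : ℕ} [AddCommGroup V] [Module ℝ V] [AddCommGroup W] [Module ℝ W]

theorem map_firstChild (t : TaggedSimplex V d) (f : V →ᵃ[ℝ] W) :
    t.firstChild.map f = (t.map f).firstChild := by
  simp only [map, firstChild, mk.injEq, and_true]
  funext j
  cases j using Fin.cases with
  | zero => rfl
  | succ k =>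
    simp only [Function.comp_apply, Fin.cons_succ]
    split_ifs
    · rw [AffineMap.map_midpoint]
    · rfl

theorem map_child (t : TaggedSimplex V d) (f : V →ᵃ[ℝ] W) (b : Bool) :
    (t.child b).map f = (t.map f).child b := by
  cases b
  · exact map_firstChild t f
  · exact map_firstChild t.reflect f

theorem _root_.AffineIndependent.exists_affineMap_eq {ι : Type*} {p : ι → V}
    (hp : AffineIndependent ℝ p) (a : ι → ℝ) : ∃ f : V →ᵃ[ℝ] ℝ, ∀ i, f (p i) = a i := by
  rcases isEmpty_or_nonempty ι with hι | ⟨⟨i₀⟩⟩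
  · exact ⟨AffineMap.const ℝ V 0, fun i => (hι.false i).elim⟩
  · have hli := (affineIndependent_iff_linearIndependent_vsub ℝ p i₀).1 hp
    obtain ⟨g, hg⟩ := LinearMap.exists_extend
      ((Module.Basis.span hli).constr ℝ fun i => a i - a i₀)
    have hgv : ∀ i : {i // i ≠ i₀}, g (p i -ᵥ p i₀) = a i - a i₀ := fun i => by
      have h1 := LinearMap.congr_fun hg (Module.Basis.span hli i)
      rw [Module.Basis.constr_basis, LinearMap.comp_apply, Submodule.subtype_apply,
        Module.Basis.span_apply] at h1
      exact h1
    refine ⟨g.toAffineMap + AffineMap.const ℝ V (a i₀ - g (p i₀)), fun i => ?_⟩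
    by_cases hi : i = i₀
    · subst hi
      simp
    · have := hgv ⟨i, hi⟩
      simp only [vsub_eq_sub, map_sub] at this
      simp only [AffineMap.coe_add, LinearMap.coe_toAffineMap, AffineMap.coe_const, Pi.add_apply,
        Function.const_apply]
      linarith

end Map

end TaggedSimplex

open TaggedSimplex

/-! ### Meshes on the surface: uniform refinements and existence of REFINE -/

section Surface

variable {d M : ℕ} {Ω : Affine.Simplex ℝ (E d) d} (K : PolyhedralSurface d M Ω) (L : Labeling d M)

theorem surfSimplex_child (T : Elem M) (b : Bool) :
    surfSimplex K L (T.child b) = (surfSimplex K L T).child b :=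
  map_child (paramSimplex Ω L T.1 T.2) (K.X₀ T.1) b

theorem surfSimplex_nondeg (hd : 0 < d) (T : Elem M) : (surfSimplex K L T).Nondeg := by
  induction T using Elem.induction with
  | root i =>
    have h := (Ω.independent.map' (K.X₀ i) (K.injective i)).comp_embedding (L.order i).toEmbedding
    exact fun a => h.exists_affineMap_eq a
  | child T b ih =>
    rw [surfSimplex_child]
    exact ih.child hd b

theorem surfSimplex_root_vertices (i : Fin M) :
    (surfSimplex K L (i, [])).vertices = K.X₀ i '' Set.range Ω.points := by
  rw [← Set.range_comp]
  exact (L.order i).surjective.range_comp (K.X₀ i ∘ Ω.points)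

theorem surfSimplex_root_region (i : Fin M) :
    (surfSimplex K L (i, [])).region = K.X₀ i '' refRegion Ω := by
  rw [region, surfSimplex_root_vertices, refRegion, AffineMap.image_convexHull]

theorem surfSimplex_root_conf (i j : Fin M) :
    Conf (surfSimplex K L (i, [])) (surfSimplex K L (j, [])) := by
  refine conf_of_subset ?_
  rw [surfSimplex_root_region, surfSimplex_root_region, surfSimplex_root_vertices,
    surfSimplex_root_vertices]
  exact K.conforming i j

variable {K L}

/-- Matching is assumed only across `(d-1)`-faces. For macro-elements sharing a smaller face it is
carried along the chain around that face: every member contains the face, so refinement edges in it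
and positions of its vertices can be compared step by step. -/
theorem surfSimplex_root_labelCompat (hd : 0 < d) (hA : IsAdmissible K L) (i j : Fin M) :
    LabelCompat (surfSimplex K L (i, [])) (surfSimplex K L (j, [])) := by
  have hnd := surfSimplex_nondeg K L hd
  set t : Fin M → TaggedSimplex (E (d + 1)) d := fun i => surfSimplex K L (i, []) with ht
  have htype : ∀ k l, (t k).type = (t l).type := hA.1
  have hlt : ∀ k, (t k).type < d := L.type_lt
  have hv : ∀ k, (t k).vertices = K.X₀ k '' Set.range Ω.points := surfSimplex_root_vertices K L
  have hstep : ∀ k l, ((t k).vertices ∩ (t l).vertices).ncard = d → LabelCompat (t k) (t l) := by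
    intro k l h
    have hkl : k ≠ l := by
      rintro rfl
      rw [Set.inter_self, vertices, Set.ncard_range_of_injective (hnd _).injective,
        Nat.card_eq_fintype_card, Fintype.card_fin] at h
      omega
    exact (hA.2 k l hkl h).labelCompat hd (hnd _) (hnd _) (htype k l) (hlt k) h
  have hchain : ∀ i j, ((t i).vertices ∩ (t j).vertices).Nonempty →
      Relation.ReflTransGen (fun k l => LabelCompat (t k) (t l) ∧
        (t i).vertices ∩ (t j).vertices ⊆ (t k).vertices ∩ (t l).vertices) i j := by
    intro i j h
    rw [hv, hv] at h
    refine (K.chain i j h).lift id fun k l hkl => ⟨hstep k l ?_, ?_⟩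
    · rw [hv, hv]
      exact hkl.1
    · rw [hv, hv, hv, hv]
      exact hkl.2
  have hedge : ∀ i j, EdgeCompat (t i) (t j) := by
    intro i j he
    have he' := Set.subset_inter (t i).refinementEdge_subset he
    have hne : ((t i).vertices ∩ (t j).vertices).Nonempty := ⟨_, he' (Or.inl rfl)⟩
    have : ∀ l, Relation.ReflTransGen (fun k l => LabelCompat (t k) (t l) ∧
        (t i).vertices ∩ (t j).vertices ⊆ (t k).vertices ∩ (t l).vertices) i l →
        (t i).refinementEdge = (t l).refinementEdge := by
      intro l hl
      induction hl with
      | refl => rfl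
      | tail _ hkl ih =>
        rw [ih]
        refine hkl.1.edgeCompat ?_
        rw [← ih]
        exact he'.trans (hkl.2.trans Set.inter_subset_right)
    exact this j (hchain i j hne)
  refine ⟨htype i j, hlt i, fun _ => ⟨hedge i j, hedge j i⟩, fun hd2 => ?_⟩
  have hpos : PosCompatOn ((t i).vertices ∩ (t j).vertices) (t i) (t j) := by
    rcases ((t i).vertices ∩ (t j).vertices).eq_empty_or_nonempty with h | h
    · rw [h]
      exact ⟨htype i j, fun _ _ _ m => m.elim, fun _ _ _ _ _ m => m.elim⟩
    · have : ∀ l, Relation.ReflTransGen (fun k l => LabelCompat (t k) (t l) ∧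
          (t i).vertices ∩ (t j).vertices ⊆ (t k).vertices ∩ (t l).vertices) i l →
          PosCompatOn ((t i).vertices ∩ (t j).vertices) (t i) (t l) := by
        intro l hl
        induction hl with
        | refl => exact .refl (hnd _).injective _
        | tail _ hkl ih =>
          exact ih.trans ((hkl.1.pos hd2).mono (Set.subset_univ _))
            (hkl.2.trans Set.inter_subset_left)
      exact this j (hchain i j h)
  exact ⟨htype i j, fun a b e _ => hpos.newest a b e ⟨⟨a, rfl⟩, ⟨b, e.symm⟩⟩,
    fun a b c e h _ h' _ => hpos.path a b c e h ⟨⟨a, rfl⟩, ⟨b, h.symm⟩⟩ h'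
      ⟨⟨c, rfl⟩, ⟨e, h'.symm⟩⟩⟩

/-- Uniform refinements of an admissibly labeled triangulation are conforming. -/
theorem conf_of_generation_eq (hd : 0 < d) (hA : IsAdmissible K L) (T T' : Elem M)
    (h : T.generation = T'.generation) :
    Conf (surfSimplex K L T) (surfSimplex K L T') := by
  -- Conformity alone is not inherited by children; the induction must carry the labels as well.
  suffices H : ∀ n, ∀ T T' : Elem M, T.generation = n → T'.generation = n →
      Conf (surfSimplex K L T) (surfSimplex K L T') ∧
        LabelCompat (surfSimplex K L T) (surfSimplex K L T') from (H _ T T' rfl h.symm).1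
  intro n
  induction n with
  | zero =>
    intro T T' hT hT'
    obtain ⟨i, rfl⟩ | ⟨S, b, rfl⟩ := T.root_or_child
    · obtain ⟨j, rfl⟩ | ⟨S, b, rfl⟩ := T'.root_or_child
      · exact ⟨surfSimplex_root_conf K L i j, surfSimplex_root_labelCompat hd hA i j⟩
      · simp at hT'
    · simp at hT
  | succ n ih =>
    intro T T' hT hT'
    obtain ⟨i, rfl⟩ | ⟨S, b, rfl⟩ := T.root_or_child
    · exact absurd hT.symm (Nat.succ_ne_zero _)
    obtain ⟨i, rfl⟩ | ⟨S', b', rfl⟩ := T'.root_or_child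
    · exact absurd hT'.symm (Nat.succ_ne_zero _)
    rw [surfSimplex_child, surfSimplex_child]
    obtain ⟨hc, hl⟩ := ih S S' (by simpa using hT) (by simpa using hT')
    exact hc.child hd (surfSimplex_nondeg K L hd S) (surfSimplex_nondeg K L hd S') hl b b'

theorem region_subset_of_isDescendant (hd : 0 < d) {S T : Elem M} (h : S.IsDescendant T) :
    (surfSimplex K L T).region ⊆ (surfSimplex K L S).region := by
  induction T using Elem.induction with
  | root i =>
    have : S = (i, []) := h.antisymm ⟨h.1.symm, List.nil_suffix⟩
    rw [this]
  | child T b ih =>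
    rcases Elem.isDescendant_child_iff.1 h with rfl | h
    · exact subset_rfl
    · rw [surfSimplex_child]
      exact (child_region_subset hd _ b).trans (ih h)

theorem Elem.exists_isDescendant_generation (T : Elem M) {n : ℕ} (hn : n ≤ T.generation) :
    ∃ S : Elem M, S.IsDescendant T ∧ S.generation = n :=
  ⟨(T.1, T.2.drop (T.generation - n)), ⟨rfl, List.drop_suffix _ _⟩, by
    simp only [Elem.generation, List.length_drop] at hn ⊢
    omega⟩

/-- Two elements of the forest meet in a common face if neither of them has a vertex that is a
hanging node of the other. -/
theorem conf_of_no_hanging_node (hd : 0 < d) (hA : IsAdmissible K L) {T T' : Elem M}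
    (h : (surfSimplex K L T').vertices ∩ (surfSimplex K L T).region ⊆ (surfSimplex K L T).vertices)
    (h' : (surfSimplex K L T).vertices ∩ (surfSimplex K L T').region ⊆
      (surfSimplex K L T').vertices) :
    Conf (surfSimplex K L T) (surfSimplex K L T') := by
  wlog hg : T.generation ≤ T'.generation generalizing T T'
  · exact (this h' h (le_of_not_ge hg)).symm
  -- `T'` lies in its ancestor `A` of the generation of `T`, and `A` meets `T` in a common face. The
  -- part of `T'` in this face of `A` is spanned by vertices of `T'` lying in `T`.
  obtain ⟨A, hAT, hAg⟩ := T'.exists_isDescendant_generation hg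
  have hc := conf_of_generation_eq hd hA T A hAg.symm
  have hsub := region_subset_of_isDescendant (K := K) (L := L) hd hAT
  refine conf_of_subset ?_
  rintro z ⟨hz, hz'⟩
  have hzF : z ∈ convexHull ℝ ((surfSimplex K L T).vertices ∩ (surfSimplex K L A).vertices) :=
    hc ▸ ⟨hz, hsub hz'⟩
  have hzs := (surfSimplex_nondeg K L hd A).convexHull_inter_face Set.inter_subset_right
    ((subset_convexHull ℝ _).trans hsub) hz' hzF
  refine convexHull_mono ?_ hzs
  rintro v ⟨hv, hvF⟩
  have hvT : v ∈ (surfSimplex K L T).region := convexHull_mono Set.inter_subset_left hvF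
  exact ⟨h ⟨hv, hvT⟩, hv⟩

/-- Bisection never discards a vertex: each old vertex passes to one of the children, and so on down
to the mesh. -/
theorem exists_vertex_of_interior (hd : 0 < d) {I 𝒯 : Finset (Elem M)} (h : IsInterior I 𝒯)
    {T : Elem M} (hT : T ∈ I ∨ T ∈ 𝒯) {v : E (d + 1)} (hv : v ∈ (surfSimplex K L T).vertices) :
    ∃ S ∈ 𝒯, v ∈ (surfSimplex K L S).vertices := by
  refine h.exists_of_child (P := fun T => v ∈ (surfSimplex K L T).vertices) (fun T hT => ?_) hT hv
  obtain ⟨b, hb⟩ := (surfSimplex_nondeg K L hd T).exists_mem_child hd hT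
  exact ⟨b, by rwa [surfSimplex_child]⟩

/-- A node of the intersection of two bisection forests has no hanging nodes. -/
theorem no_hanging_node_of_isLeaf_inter (hd : 0 < d) {I₁ I₂ 𝒯₁ 𝒯₂ : Finset (Elem M)}
    (h₁ : IsInterior I₁ 𝒯₁) (h₂ : IsInterior I₂ 𝒯₂) (hc₁ : IsConforming K L 𝒯₁)
    (hc₂ : IsConforming K L 𝒯₂) {T T' : Elem M} (hT : IsLeaf (I₁ ∩ I₂) T)
    (hT' : IsLeaf (I₁ ∩ I₂) T') :
    (surfSimplex K L T').vertices ∩ (surfSimplex K L T).region ⊆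
      (surfSimplex K L T).vertices := by
  rintro v ⟨hv, hvT⟩
  have hT'' := h₁.mem_of_isLeaf_inter h₂ hT'
  rcases h₁.mem_of_isLeaf_inter h₂ hT with ⟨hm, -⟩ | ⟨hm, -⟩
  · obtain ⟨S, hS, hvS⟩ := exists_vertex_of_interior hd h₁ (by tauto) hv
    exact (surfSimplex_nondeg K L hd S).mem_vertices_of_mem_region (hc₁ S hS T hm) hvS hvT
  · obtain ⟨S, hS, hvS⟩ := exists_vertex_of_interior hd h₂ (by tauto) hv
    exact (surfSimplex_nondeg K L hd S).mem_vertices_of_mem_region (hc₂ S hS T hm) hvS hvT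

/-- The forest contains the mesh of all elements of a given generation. -/
theorem exists_uniform_mem_forest (hd : 0 < d) (hA : IsAdmissible K L) (k : ℕ) :
    ∃ 𝒰 ∈ forest K L, IsInterior (nodesBelow M k) 𝒰 ∧ ∀ T, T ∈ 𝒰 ↔ T.generation = k := by
  obtain ⟨𝒰, h, hI, hm⟩ := exists_uniformMesh M k
  refine ⟨𝒰, ⟨h, fun T hT T' hT' => ?_⟩, hI, hm⟩
  exact conf_of_generation_eq hd hA T T' (((hm T).1 hT).trans ((hm T').1 hT').symm)

/-- A uniform mesh of sufficiently high generation qualifies. -/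
theorem refinements_nonempty (hd : 0 < d) (hA : IsAdmissible K L) (b : ℕ) {𝒯 : Finset (Elem M)}
    (h𝒯 : IsBisectionMesh 𝒯) (𝓜 : Finset (Elem M)) : (refinements K L b 𝒯 𝓜).Nonempty := by
  obtain ⟨I, hI⟩ := h𝒯.exists_isInterior
  obtain ⟨𝒰, hU, hUI, hm⟩ := exists_uniform_mem_forest hd hA
    ((I ∪ 𝓜).sup Elem.generation + 1 + b)
  have hle : ∀ T ∈ I ∪ 𝓜, T.generation ≤ (I ∪ 𝓜).sup Elem.generation := fun T hT =>
    Finset.le_sup hT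
  refine ⟨𝒰, hU, (hI.refines_iff hUI).2 fun T hT => ?_, fun T hT T' hT' _ => ?_⟩
  · have := hle T (Finset.mem_union_left _ hT)
    rw [mem_nodesBelow]
    omega
  · have := hle T (Finset.mem_union_right _ hT)
    rw [(hm T').1 hT']
    omega

/-- The module `REFINE` is well defined. -/
theorem exists_isREFINE (hd : 0 < d) (hA : IsAdmissible K L) (b : ℕ) {𝒯 : Finset (Elem M)}
    (h𝒯 : IsBisectionMesh 𝒯) (𝓜 : Finset (Elem M)) : ∃ 𝒯', IsREFINE K L b 𝒯 𝓜 𝒯' := by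
  obtain ⟨I₀, hI₀⟩ := h𝒯.exists_isInterior
  have hex : ∃ n, ∃ 𝒯' I, 𝒯' ∈ refinements K L b 𝒯 𝓜 ∧ IsInterior I 𝒯' ∧ I.card = n := by
    obtain ⟨𝒰, hU⟩ := refinements_nonempty hd hA b h𝒯 𝓜
    obtain ⟨I, hI⟩ := hU.1.1.exists_isInterior
    exact ⟨_, 𝒰, I, hU, hI, rfl⟩
  classical
  -- Choose a refinement with the fewest bisected nodes. Intersecting with any competitor gives an
  -- admissible refinement again, so by minimality the intersection is all of `I'`.
  obtain ⟨𝒯', I', hT', hI', hcard⟩ := Nat.find_spec hex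
  have hT₀ := hT'
  refine ⟨𝒯', hT', fun 𝒰 hU => ?_⟩
  obtain ⟨J, hJ⟩ := hU.1.1.exists_isInterior
  obtain ⟨𝒱, hV, hVI⟩ := (hI'.1.inter hJ.1).exists_isBisectionMesh
  have hVmem : 𝒱 ∈ refinements K L b 𝒯 𝓜 := by
    refine ⟨⟨hV, fun T hT T' hT' => ?_⟩, (hI₀.refines_iff hVI).2 (Finset.subset_inter
      ((hI₀.refines_iff hI').1 hT'.2.1) ((hI₀.refines_iff hJ).1 hU.2.1)), fun T hT S hS hTS => ?_⟩
    · have hl := (hVI.2 T).1 hT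
      have hl' := (hVI.2 T').1 hT'
      exact conf_of_no_hanging_node hd hA
        (no_hanging_node_of_isLeaf_inter hd hI' hJ hT₀.1.2 hU.1.2 hl hl')
        (no_hanging_node_of_isLeaf_inter hd hI' hJ hT₀.1.2 hU.1.2 hl' hl)
    · rcases hI'.mem_of_isLeaf_inter hJ ((hVI.2 S).1 hS) with ⟨h, -⟩ | ⟨h, -⟩
      · exact hT'.2.2 T hT S h hTS
      · exact hU.2.2 T hT S h hTS
  have hmin : I'.card ≤ (I' ∩ J).card := by
    rw [hcard]
    exact Nat.find_min' hex ⟨𝒱, _, hVmem, hVI, rfl⟩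
  rw [hI'.refines_iff hJ]
  rw [← Finset.eq_of_subset_of_card_le Finset.inter_subset_left hmin]
  exact Finset.inter_subset_right

/-- If `T` were not bisected, it would lie below or be an element of `𝒯'`. Since `𝒯'` refines `𝒯`,
that element is `T` itself, which has not been bisected `b ≥ 1` times. -/
theorem marked_mem_interior {𝒯 𝒯' 𝓜 I I' : Finset (Elem M)} {b : ℕ} (hb : 1 ≤ b)
    (hI : IsInterior I 𝒯) (hI' : IsInterior I' 𝒯') (h𝓜 : 𝓜 ⊆ 𝒯)
    (h : 𝒯' ∈ refinements K L b 𝒯 𝓜) {T : Elem M} (hT : T ∈ 𝓜) : T ∈ I' := by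
  by_contra hn
  have hleaf := (hI.2 T).1 (h𝓜 hT)
  obtain ⟨S, hS, hST⟩ := exists_isLeaf_isDescendant hn
  have hS' := (hI'.2 S).2 hS
  obtain ⟨R, hR, hRS⟩ := h.2.1 S hS'
  obtain rfl := ((hI.2 R).1 hR).eq_of_isDescendant hI.1 hleaf (hRS.trans hST)
  have := h.2.2 R hT S hS' hRS
  have := hST.generation_le
  omega

end Surface

end

section

open TaggedSimplex MeasureTheory

/-! ### Bisection halves volumes -/

section Volume

variable {d : ℕ}

/-- The linear part of the affine map that takes the standard simplex to `t`. -/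
noncomputable def edgeMap (t : TaggedSimplex (E d) d) : E d →ₗ[ℝ] E d :=
  (EuclideanSpace.basisFun (Fin d) ℝ).toBasis.constr ℝ fun k => t.vert k.succ - t.vert 0

/-- The standard simplex. -/
def stdRegion (d : ℕ) : Set (E d) :=
  convexHull ℝ (Set.range (Fin.cons 0 (EuclideanSpace.basisFun (Fin d) ℝ) : Fin (d + 1) → E d))

theorem region_eq_image_stdRegion (t : TaggedSimplex (E d) d) :
    t.region = (t.vert 0 + ·) '' (edgeMap t '' stdRegion d) := by
  rw [stdRegion, LinearMap.image_convexHull]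
  have h : ∀ s : Set (E d), (t.vert 0 + ·) '' convexHull ℝ s =
      convexHull ℝ ((t.vert 0 + ·) '' s) := fun s => by
    have := AffineMap.image_convexHull
      (AffineMap.const ℝ (E d) (t.vert 0) + AffineMap.id ℝ (E d)) s
    exact this
  rw [h, ← Set.range_comp, ← Set.range_comp, region, vertices]
  congr 2
  funext j
  cases j using Fin.cases with
  | zero => simp
  | succ k =>
    have : edgeMap t (EuclideanSpace.basisFun (Fin d) ℝ k) = t.vert k.succ - t.vert 0 := by
      have := (EuclideanSpace.basisFun (Fin d) ℝ).toBasis.constr_basis ℝ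
        (fun k => t.vert k.succ - t.vert 0) k
      simpa only [edgeMap, OrthonormalBasis.coe_toBasis] using this
    simp only [Function.comp_apply, Fin.cons_succ, this]
    abel

theorem volume_region (t : TaggedSimplex (E d) d) :
    volume.real t.region = |LinearMap.det (edgeMap t)| * volume.real (stdRegion d) := by
  rw [region_eq_image_stdRegion, Measure.real, Set.image_add_left, measure_preimage_add,
    Measure.addHaar_image_linearMap, ENNReal.toReal_mul, ENNReal.toReal_ofReal (abs_nonneg _),
    Measure.real]

theorem firstChild_region_eq (hd : 0 < d) (t : TaggedSimplex (E d) d) :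
    t.firstChild.region =
      (⟨Function.update t.vert (Fin.last d) t.mid, 0⟩ : TaggedSimplex (E d) d).region := by
  rw [region, region]
  congr 1
  ext v
  rw [mem_firstChild_vertices hd]
  constructor
  · rintro (rfl | ⟨j, hj, rfl⟩)
    · exact ⟨Fin.last d, by simp⟩
    · exact ⟨j, by simp [hj]⟩
  · rintro ⟨j, rfl⟩
    by_cases hj : j = Fin.last d
    · left
      simp [hj]
    · exact Or.inr ⟨j, hj, by simp [hj]⟩

/-- The child has the vertices of `t` with `x_d` replaced by the midpoint. This halves one edge
vector issuing from `x₀`, and hence the determinant. -/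
theorem volume_firstChild (hd : 0 < d) (t : TaggedSimplex (E d) d) :
    volume.real t.firstChild.region = volume.real t.region / 2 := by
  rw [firstChild_region_eq hd, volume_region, volume_region]
  set b := (EuclideanSpace.basisFun (Fin d) ℝ).toBasis with hb
  let c : Fin d → ℝ := fun k => if k.succ = Fin.last d then 1 / 2 else 1
  let D : E d →ₗ[ℝ] E d := b.constr ℝ fun k => c k • b k
  have hD : ∀ k, D (b k) = c k • b k := fun k => b.constr_basis ℝ _ k
  have hdet : LinearMap.det D = 1 / 2 := by
    have : LinearMap.toMatrix b b D = Matrix.diagonal c := by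
      ext i j
      rw [LinearMap.toMatrix_apply, hD, map_smul, Finsupp.smul_apply, Module.Basis.repr_self,
        Matrix.diagonal_apply, Finsupp.single_apply, smul_eq_mul]
      by_cases h : i = j
      · simp [h]
      · simp [h, Ne.symm h]
    rw [← LinearMap.det_toMatrix b, this, Matrix.det_diagonal]
    obtain ⟨n, rfl⟩ : ∃ n, d = n + 1 := ⟨d - 1, by omega⟩
    have hc : ∀ k : Fin (n + 1), c k = if k = Fin.last n then 1 / 2 else 1 := fun k => by
      simp only [c, ← Fin.succ_last, Fin.succ_inj]
    simp [hc, Finset.prod_ite_eq']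
  have h0 : (0 : Fin (d + 1)) ≠ Fin.last d := fun h => by
    have := congrArg Fin.val h
    simp only [Fin.val_zero, Fin.val_last] at this
    omega
  have hcomp : edgeMap (⟨Function.update t.vert (Fin.last d) t.mid, 0⟩ : TaggedSimplex (E d) d) =
      edgeMap t ∘ₗ D := by
    refine b.ext fun k => ?_
    rw [LinearMap.comp_apply, hD, map_smul, edgeMap, edgeMap, ← hb, b.constr_basis,
      b.constr_basis]
    by_cases hk : k.succ = Fin.last d
    · simp only [hk, c, Function.update_self, Function.update_of_ne h0, if_true]
      rw [mid, midpoint_eq_smul_add, invOf_eq_inv]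
      module
    · simp only [hk, c, Function.update_of_ne h0, if_false, one_smul]
      rw [Function.update_of_ne hk]
  rw [hcomp, LinearMap.det_comp, hdet, abs_mul]
  norm_num
  ring

theorem volume_paramSimplex (hd : 0 < d) {M : ℕ} (Ω : Affine.Simplex ℝ (E d) d) (L : Labeling d M)
    (T : Elem M) :
    volume.real (paramSimplex Ω L T.1 T.2).region =
      volume.real (refRegion Ω) / 2 ^ T.generation := by
  induction T using Elem.induction with
  | root i =>
    have : (paramSimplex Ω L i []).region = refRegion Ω := by
      rw [region, refRegion]
      exact congrArg _ ((L.order i).surjective.range_comp Ω.points)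
    simp [this, Elem.generation]
  | child T b ih =>
    have : volume.real (paramSimplex Ω L (T.child b).1 (T.child b).2).region =
        volume.real (paramSimplex Ω L T.1 T.2).region / 2 := by
      cases b
      · exact volume_firstChild hd _
      · exact (volume_firstChild hd (paramSimplex Ω L T.1 T.2).reflect).trans
          (by rw [reflect_region])
    rw [this, ih, Elem.generation_child, pow_succ]
    ring

theorem meshSize_rpow (hd : 0 < d) {M : ℕ} (Ω : Affine.Simplex ℝ (E d) d) (L : Labeling d M)
    (T : Elem M) (r : ℝ) :
    meshSize Ω L T ^ r =
      volume.real (refRegion Ω) ^ (r / d) / ((2 : ℝ) ^ T.generation) ^ (r / d) := by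
  rw [meshSize, volume_paramSimplex hd, ← Real.rpow_mul (by positivity),
    Real.div_rpow (by positivity) (by positivity), one_div, inv_mul_eq_div]

end Volume

/-! ### Geometric sums over the generations -/

section Counting

variable {M : ℕ}

theorem card_le_of_generation (k : ℕ) (F : Finset (Elem M)) (h : ∀ T ∈ F, T.generation = k) :
    F.card ≤ M * 2 ^ k := by
  classical
  induction k generalizing F with
  | zero =>
    have : F ⊆ initialMesh M := fun T hT => by
      rcases T.root_or_child with ⟨i, rfl⟩ | ⟨S, b, rfl⟩
      · simp [initialMesh]
      · simpa using h _ hT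
    refine (Finset.card_le_card this).trans ?_
    simpa [initialMesh] using Finset.card_image_le (s := (Finset.univ : Finset (Fin M)))
      (f := fun i => ((i, []) : Elem M))
  | succ k ih =>
    let parent : Elem M → Elem M := fun T => (T.1, T.2.tail)
    have hsub : F ⊆ (F.image parent ×ˢ (Finset.univ : Finset Bool)).image
        fun x => x.1.child x.2 := fun T hT => by
      rcases T.root_or_child with ⟨i, rfl⟩ | ⟨S, b, rfl⟩
      · exact absurd (h _ hT).symm (Nat.succ_ne_zero k)
      · exact Finset.mem_image.2 ⟨(S, b), Finset.mem_product.2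
          ⟨Finset.mem_image.2 ⟨_, hT, rfl⟩, Finset.mem_univ _⟩, rfl⟩
    have h1 := (Finset.card_le_card hsub).trans Finset.card_image_le
    have h2 := ih (F.image parent) fun T hT => by
      obtain ⟨S, hS, rfl⟩ := Finset.mem_image.1 hT
      have := h S hS
      simp only [Elem.generation, parent, List.length_tail] at this ⊢
      omega
    rw [Finset.card_product, Finset.card_univ, Fintype.card_bool] at h1
    calc F.card ≤ _ := h1
      _ ≤ M * 2 ^ k * 2 := Nat.mul_le_mul_right 2 h2
      _ = M * 2 ^ (k + 1) := by ring

/-- The bound by `2 ^ K` is what makes the induction work: when `2 ^ K ≤ Y`, adding `2 ^ K` to a sum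
of at most `2 ^ K` stays below `2 * Y`. -/
theorem sum_two_pow_le {Y : ℝ} (hY : 0 ≤ Y) (K : ℕ) :
    ∑ k ∈ Finset.range K, (if (2 : ℝ) ^ k ≤ Y then (2 : ℝ) ^ k else 0) ≤ min (2 * Y) (2 ^ K) := by
  induction K with
  | zero => simp [hY]
  | succ K ih =>
    rw [Finset.sum_range_succ, pow_succ]
    have h2 : (0 : ℝ) < 2 ^ K := by positivity
    obtain ⟨h3, h4⟩ := le_min_iff.1 ih
    refine le_min_iff.2 ?_
    split_ifs with h <;> constructor <;> linarith

/-- With `u = (Y / 2 ^ K) ^ s` the next value is `ρ u`, and `(1 - ρ u) - (1 - u) = (1 - ρ) u`, so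
the right side grows by exactly the new term. The maximum with 0 covers the indices before the
threshold. -/
theorem sum_rpow_le {Y s : ℝ} (hY : 0 ≤ Y) (hs : 0 < s) (K : ℕ) :
    ∑ k ∈ Finset.range K, (if Y < 2 ^ k then (Y / 2 ^ k) ^ s else 0) ≤
      1 / (1 - (2 : ℝ) ^ (-s)) * max 0 (1 - (Y / 2 ^ K) ^ s) := by
  set ρ := (2 : ℝ) ^ (-s) with hρ
  have hρ1 : ρ < 1 := Real.rpow_lt_one_of_one_lt_of_neg one_lt_two (by linarith)
  have hG : 0 < 1 / (1 - ρ) := one_div_pos.2 (by linarith)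
  induction K with
  | zero => simpa using mul_nonneg hG.le (le_max_left _ _)
  | succ K ih =>
    have hu : (Y / 2 ^ (K + 1)) ^ s = ρ * (Y / 2 ^ K) ^ s := by
      rw [pow_succ, ← div_div, Real.div_rpow (by positivity) zero_le_two, hρ,
        Real.rpow_neg zero_le_two]
      ring
    have hu0 : 0 ≤ (Y / 2 ^ K) ^ s := by positivity
    rw [Finset.sum_range_succ, hu]
    set u := (Y / 2 ^ K) ^ s
    split_ifs with h
    · have hu1 : u ≤ 1 := Real.rpow_le_one (by positivity)
        ((div_le_one (by positivity)).2 h.le) hs.le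
      rw [max_eq_right (by linarith)] at ih
      refine (add_le_add_left ih u).trans ?_
      have : 1 / (1 - ρ) * (1 - u) + u = 1 / (1 - ρ) * (1 - ρ * u) := by
        have : 1 - ρ ≠ 0 := by linarith
        field_simp
        ring
      rw [this]
      exact mul_le_mul_of_nonneg_left (le_max_right _ _) hG.le
    · have hu1 : 1 ≤ u := Real.one_le_rpow
        ((one_le_div (by positivity)).2 (not_lt.1 h)) hs.le
      rw [max_eq_left (by linarith), mul_zero] at ih
      rw [add_zero]
      exact ih.trans (mul_nonneg hG.le (le_max_left _ _))

/-- Counting nodes generation by generation. -/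
theorem card_le_of_card_generation_le {Y s : ℝ} (hY : 0 ≤ Y) (hs : 0 < s) (F : Finset (Elem M))
    (h : ∀ k : ℕ, Y < 2 ^ k →
      (({T ∈ F | T.generation = k} : Finset (Elem M)).card : ℝ) ≤ Y * (Y / 2 ^ k) ^ s) :
    (F.card : ℝ) ≤ (2 * M + 1 / (1 - (2 : ℝ) ^ (-s))) * Y := by
  set K := F.sup Elem.generation + 1 with hK
  have hcard : F.card = ∑ k ∈ Finset.range K, ({T ∈ F | T.generation = k} : Finset _).card :=
    Finset.card_eq_sum_card_fiberwise fun T hT =>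
      Finset.mem_coe.2 (Finset.mem_range.2 (Nat.lt_succ_of_le (Finset.le_sup hT)))
  have h1 := (sum_two_pow_le hY K).trans (min_le_left _ _)
  have h2 := sum_rpow_le hY hs K
  have hG : 0 < 1 / (1 - (2 : ℝ) ^ (-s)) := one_div_pos.2
    (by linarith [Real.rpow_lt_one_of_one_lt_of_neg one_lt_two (neg_lt_zero.2 hs)])
  have h3 : max 0 (1 - (Y / 2 ^ K) ^ s) ≤ 1 :=
    max_le zero_le_one (by linarith [show 0 ≤ (Y / 2 ^ K) ^ s by positivity])
  have h4 := h2.trans (mul_le_of_le_one_right hG.le h3)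
  have h5 : (F.card : ℝ) ≤ ∑ k ∈ Finset.range K,
      (M * (if (2 : ℝ) ^ k ≤ Y then (2 : ℝ) ^ k else 0) +
        Y * (if Y < 2 ^ k then (Y / 2 ^ k) ^ s else 0)) := by
    rw [hcard, Nat.cast_sum]
    refine Finset.sum_le_sum fun k _ => ?_
    by_cases hk : (2 : ℝ) ^ k ≤ Y
    · rw [if_pos hk, if_neg (not_lt.2 hk), mul_zero, add_zero]
      exact_mod_cast card_le_of_generation k _ fun T hT => (Finset.mem_filter.1 hT).2
    · rw [if_neg hk, if_pos (not_le.1 hk), mul_zero, zero_add]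
      exact h k (not_le.1 hk)
  rw [Finset.sum_add_distrib, ← Finset.mul_sum, ← Finset.mul_sum] at h5
  have h6 := mul_le_mul_of_nonneg_left h1 (Nat.cast_nonneg (α := ℝ) M)
  have h7 := mul_le_mul_of_nonneg_left h4 hY
  linarith

end Counting

end

/-! ### The number of nodes that can be marked, and the runs of GREEDY -/

section

open TaggedSimplex MeasureTheory

variable {d M : ℕ} {Ω : Affine.Simplex ℝ (E d) d} {K : PolyhedralSurface d M Ω} {L : Labeling d M}

/-- The decay rate of the number of marked elements of a given generation. -/
noncomputable def decayRate (d : ℕ) (r : ℝ) (p : ℝ≥0∞) : ℝ :=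
  if p = ∞ then 1 else r * p.toReal / d

/-- The factor in the bound for the estimators in terms of the generation. -/
noncomputable def meshFactor (Ω : Affine.Simplex ℝ (E d) d) (r C₀ : ℝ) : ℝ :=
  C₀ * (volume.real (refRegion Ω) ^ (r / d) + 1)

/-- The constant in the bound for the number of marked elements. -/
noncomputable def greedyConstant (M : ℕ) (Ω : Affine.Simplex ℝ (E d) d) (r : ℝ) (p : ℝ≥0∞)
    (C₀ : ℝ) : ℝ :=
  (2 * M + 1 / (1 - (2 : ℝ) ^ (-decayRate d r p))) * meshFactor Ω r C₀ ^ greedyExponent d r p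

theorem decayRate_pos (hd : 0 < d) {r : ℝ} (hr : 0 < r) {p : ℝ≥0∞} (hp : 0 < p) :
    0 < decayRate d r p := by
  unfold decayRate
  split_ifs with h
  · exact one_pos
  · have := ENNReal.toReal_pos hp.ne' h
    positivity

theorem greedyExponent_pos (hd : 0 < d) {r : ℝ} (hr : 0 < r) {p : ℝ≥0∞} (hp : 0 < p) :
    0 < greedyExponent d r p := by
  unfold greedyExponent
  split_ifs with h
  · positivity
  · have := ENNReal.toReal_pos hp.ne' h
    positivity

/-- The summand 1 in `meshFactor` gives positivity without a lower bound for the volume of the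
reference simplex. -/
theorem meshFactor_pos (Ω : Affine.Simplex ℝ (E d) d) (r : ℝ) {C₀ : ℝ} (hC₀ : 0 < C₀) :
    0 < meshFactor Ω r C₀ := by
  unfold meshFactor
  have : 0 ≤ volume.real (refRegion Ω) ^ (r / d) := by positivity
  positivity

theorem greedyConstant_pos (hd : 0 < d) (M : ℕ) (Ω : Affine.Simplex ℝ (E d) d) {r : ℝ} (hr : 0 < r)
    {p : ℝ≥0∞} (hp : 0 < p) {C₀ : ℝ} (hC₀ : 0 < C₀) : 0 < greedyConstant M Ω r p C₀ := by
  have h0 : (2 : ℝ) ^ (-decayRate d r p) < 1 :=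
    Real.rpow_lt_one_of_one_lt_of_neg one_lt_two (neg_lt_zero.2 (decayRate_pos hd hr hp))
  have h1 : 0 < 1 / (1 - (2 : ℝ) ^ (-decayRate d r p)) := one_div_pos.2 (by linarith)
  have h2 := meshFactor_pos Ω r hC₀
  unfold greedyConstant
  positivity

theorem mul_meshSize_rpow_le (hd : 0 < d) (L : Labeling d M) (T : Elem M) (r : ℝ) {C₀ : ℝ}
    (hC₀ : 0 < C₀) : C₀ * meshSize Ω L T ^ r ≤
      meshFactor Ω r C₀ / ((2 : ℝ) ^ T.generation) ^ (r / d) := by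
  rw [meshSize_rpow hd, meshFactor, ← mul_div_assoc]
  gcongr
  linarith

/-- The accumulated local quantities dominate each of them. -/
theorem le_of_lpAccum_le {p : ℝ≥0∞} (hp : 0 < p) {𝒯 : Finset (Elem M)} {a : Elem M → ℝ≥0∞}
    {A : ℝ≥0∞} (h : lpAccum p 𝒯 a ≤ A) {T : Elem M} (hT : T ∈ 𝒯) : a T ≤ A := by
  refine le_trans ?_ h
  unfold lpAccum
  split_ifs with hp'
  · exact Finset.le_sup hT
  · have hp0 := ENNReal.toReal_pos hp.ne' hp'
    rw [one_div, ENNReal.le_rpow_inv_iff hp0]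
    exact Finset.single_le_sum (f := fun T => a T ^ p.toReal) (fun _ _ => zero_le) hT

theorem sum_toReal_rpow_le {p : ℝ≥0∞} (hp : 0 < p) (hp' : p ≠ ∞) {𝒯 : Finset (Elem M)}
    {a : Elem M → ℝ≥0∞} {A : ℝ≥0∞} (hA : A < ∞) (h : lpAccum p 𝒯 a ≤ A) :
    ∑ T ∈ 𝒯, (a T).toReal ^ p.toReal ≤ A.toReal ^ p.toReal := by
  have hp0 := ENNReal.toReal_pos hp.ne' hp'
  have hfin : ∀ T ∈ 𝒯, a T ^ p.toReal ≠ ∞ := fun T hT =>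
    ENNReal.rpow_ne_top_of_nonneg hp0.le ((le_of_lpAccum_le hp h hT).trans_lt hA).ne
  rw [lpAccum, if_neg hp', one_div, ENNReal.rpow_inv_le_iff hp0] at h
  have := ENNReal.toReal_mono (ENNReal.rpow_ne_top_of_nonneg hp0.le hA.ne) h
  rw [ENNReal.toReal_sum hfin] at this
  simpa [ENNReal.toReal_rpow] using this

/-- The number of nodes with a local quantity that allows them to be marked. -/
theorem card_le_of_large (hd : 0 < d) (hAd : IsAdmissible K L) {r : ℝ} (hr : 0 < r) {p : ℝ≥0∞}
    (hp : 0 < p) {C₀ : ℝ} (hC₀ : 0 < C₀) {a : Elem M → ℝ≥0∞} {A : ℝ≥0∞} (hA : A < ∞)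
    (ha : ∀ 𝒯 ∈ forest K L, lpAccum p 𝒯 a ≤ A) {δ : ℝ} (hδ : 0 < δ) (F : Finset (Elem M))
    (hF : ∀ T ∈ F, ENNReal.ofReal δ < ENNReal.ofReal (C₀ * meshSize Ω L T ^ r) * a T) :
    (F.card : ℝ) ≤ greedyConstant M Ω r p C₀ * A.toReal ^ greedyExponent d r p *
      δ ^ (-greedyExponent d r p) := by
  set e := greedyExponent d r p with he
  set s := decayRate d r p with hs
  set D := meshFactor Ω r C₀ with hD
  have hD0 : 0 < D := meshFactor_pos Ω r hC₀
  have hs0 : 0 < s := decayRate_pos hd hr hp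
  have hA0 : 0 ≤ A.toReal := ENNReal.toReal_nonneg
  have hd0 : (0 : ℝ) < d := by exact_mod_cast hd
  set x := D * A.toReal / δ with hx
  have hx0 : 0 ≤ x := by positivity
  have hY : D ^ e * A.toReal ^ e * δ ^ (-e) = x ^ e := by
    rw [hx, Real.div_rpow (by positivity) hδ.le, Real.mul_rpow hD0.le hA0, Real.rpow_neg hδ.le,
      div_eq_mul_inv]
  have hreal : ∀ T ∈ F, (a T).toReal ≤ A.toReal ∧
      δ < D / ((2 : ℝ) ^ T.generation) ^ (r / d) * (a T).toReal := by
    intro T hT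
    -- Every node belongs to the uniform mesh of its generation, so its local quantity is bounded by
    -- `A` and in particular finite.
    obtain ⟨𝒰, hU, -, hm⟩ := exists_uniform_mem_forest hd hAd T.generation
    have hle := le_of_lpAccum_le hp (ha 𝒰 hU) ((hm T).2 rfl)
    have hlt := (hF T hT).trans_le (mul_le_mul_left
      (ENNReal.ofReal_le_ofReal (mul_meshSize_rpow_le hd L T r hC₀)) (a T))
    rw [← ENNReal.ofReal_toReal (hle.trans_lt hA).ne, ← ENNReal.ofReal_mul (by positivity),
      ENNReal.ofReal_lt_ofReal_iff_of_nonneg hδ.le] at hlt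
    exact ⟨ENNReal.toReal_mono hA.ne hle, hlt⟩
  have hcount := card_le_of_card_generation_le (Y := x ^ e) (by positivity) hs0 F (fun k hk => by
    set G : Finset (Elem M) := {T ∈ F | T.generation = k} with hG
    have hz0 : (0 : ℝ) < ((2 : ℝ) ^ k) ^ (r / d) := by positivity
    -- For `p = ∞` a large node satisfies `2 ^ k < x ^ (d / r) = Y`, so none lie above the
    -- threshold, and any positive decay rate would do.
    by_cases hp' : p = ∞
    · have hGe : G = ∅ := by
        rw [Finset.eq_empty_iff_forall_notMem]
        intro T hT
        obtain ⟨hTF, hTk⟩ := Finset.mem_filter.1 hT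
        obtain ⟨h1, h2⟩ := hreal T hTF
        rw [hTk] at h2
        have h3 : δ < D / ((2 : ℝ) ^ k) ^ (r / d) * A.toReal :=
          h2.trans_le (mul_le_mul_of_nonneg_left h1 (by positivity))
        have h4 : ((2 : ℝ) ^ k) ^ (r / d) < x := by
          rw [hx, lt_div_iff₀ hδ]
          rw [div_mul_eq_mul_div, lt_div_iff₀ hz0] at h3
          linarith
        have h5 : (2 : ℝ) ^ k < x ^ e := by
          have h6 := Real.rpow_lt_rpow hz0.le h4 (greedyExponent_pos hd hr hp)
          rw [← Real.rpow_mul (by positivity)] at h6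
          have h7 : r / d * greedyExponent d r p = 1 := by
            rw [greedyExponent, if_pos hp']
            field_simp
          rwa [h7, Real.rpow_one] at h6
        exact absurd h5 (not_lt.2 hk.le)
      rw [hGe, Finset.card_empty, Nat.cast_zero]
      positivity
    · have hP := ENNReal.toReal_pos hp.ne' hp'
      set P := p.toReal with hPdef
      obtain ⟨𝒰, hU, -, hm⟩ := exists_uniform_mem_forest hd hAd k
      have hGU : G ⊆ 𝒰 := fun T hT => (hm T).2 (Finset.mem_filter.1 hT).2
      have hsum := (Finset.sum_le_sum_of_subset_of_nonneg hGU fun T _ _ =>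
        Real.rpow_nonneg ENNReal.toReal_nonneg P).trans (sum_toReal_rpow_le hp hp' hA (ha 𝒰 hU))
      have h1 : ∑ T ∈ G, δ ^ P ≤
          ∑ T ∈ G, (D / ((2 : ℝ) ^ k) ^ (r / d)) ^ P * (a T).toReal ^ P := by
        refine Finset.sum_le_sum fun T hT => ?_
        obtain ⟨hTF, hTk⟩ := Finset.mem_filter.1 hT
        have h2 := (hreal T hTF).2
        rw [hTk] at h2
        rw [← Real.mul_rpow (by positivity) ENNReal.toReal_nonneg]
        exact Real.rpow_le_rpow hδ.le h2.le hP.le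
      rw [Finset.sum_const, nsmul_eq_mul, ← Finset.mul_sum] at h1
      have h2 : (G.card : ℝ) * δ ^ P ≤
          (D / ((2 : ℝ) ^ k) ^ (r / d)) ^ P * A.toReal ^ P :=
        h1.trans (mul_le_mul_of_nonneg_left hsum (by positivity))
      have h3 : (G.card : ℝ) ≤ x ^ P / ((2 : ℝ) ^ k) ^ s := by
        have hsr : r / d * P = s := by
          rw [hs, decayRate, if_neg hp']
          ring
        rw [← hsr, Real.rpow_mul (by positivity), ← Real.div_rpow hx0 hz0.le]
        have h4 : x / ((2 : ℝ) ^ k) ^ (r / d) = D / ((2 : ℝ) ^ k) ^ (r / d) * A.toReal / δ := by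
          rw [hx]
          ring
        rw [h4, Real.div_rpow (by positivity) hδ.le, Real.mul_rpow (by positivity) hA0,
          le_div_iff₀ (by positivity)]
        exact h2
      refine h3.trans_eq ?_
      -- This identity determines the exponent `e`: it gives `Y * Y ^ s = x ^ P`, so that the `ℓ_p`
      -- count has the form required for summation.
      have heP : e + e * s = P := by
        rw [he, hs, greedyExponent, decayRate, if_neg hp', if_neg hp', ← hPdef]
        have : (d : ℝ) + r * P ≠ 0 := by positivity
        field_simp
      rw [Real.div_rpow (x := x ^ e) (by positivity) (by positivity), ← mul_div_assoc,
        ← Real.rpow_mul hx0, ← Real.rpow_add_of_nonneg hx0 (greedyExponent_pos hd hr hp).le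
        (mul_nonneg (greedyExponent_pos hd hr hp).le hs0.le), heP])
  refine hcount.trans_eq ?_
  rw [← hY, greedyConstant]
  ring

/-- Elements that are marked in a pass of the loop are bisected in it, and bisected nodes remain
so. -/
theorem GreedyStep.interior {b : ℕ} (hb : 1 ≤ b) {ζ : Finset (Elem M) → Elem M → ℝ≥0∞} {δ : ℝ}
    {𝒯 𝒯' : Finset (Elem M)} (h : GreedyStep K L b ζ δ 𝒯 𝒯') {I I' : Finset (Elem M)}
    (hI : IsInterior I 𝒯) (hI' : IsInterior I' 𝒯') : I ⊆ I' ∧ marked ζ δ 𝒯 ⊆ I' :=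
  ⟨(hI.refines_iff hI').1 h.2.1.2.1, fun _ hT =>
    marked_mem_interior hb hI hI' (Finset.filter_subset _ _) h.2.1 hT⟩

section Run

variable {b : ℕ} {ζ : Finset (Elem M) → Elem M → ℝ≥0∞} {δ : ℝ} {Q : Finset (Elem M)}

/-- The number of nodes that may still be marked decreases by the number of marked elements. -/
theorem GreedyStep.card_add_le (hb : 1 ≤ b) (hQ : ∀ 𝒯 ∈ forest K L, marked ζ δ 𝒯 ⊆ Q)
    {𝒯 𝒯' : Finset (Elem M)} (h𝒯 : 𝒯 ∈ forest K L) (h : GreedyStep K L b ζ δ 𝒯 𝒯')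
    {I I' : Finset (Elem M)} (hI : IsInterior I 𝒯) (hI' : IsInterior I' 𝒯') :
    (marked ζ δ 𝒯).card + (Q \ I').card ≤ (Q \ I).card := by
  obtain ⟨h1, h2⟩ := h.interior hb hI hI'
  rw [← Finset.card_union_of_disjoint]
  · refine Finset.card_le_card (Finset.union_subset (fun T hT => ?_)
      (Finset.sdiff_subset_sdiff subset_rfl h1))
    exact Finset.mem_sdiff.2 ⟨hQ 𝒯 h𝒯 hT,
      ((hI.2 T).1 (Finset.filter_subset _ _ hT)).1⟩
  · exact Finset.disjoint_of_subset_left h2 Finset.disjoint_sdiff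

/-- The decrease of `Q \ I` in each pass telescopes over the run. -/
theorem GreedyRun.le_card (hb : 1 ≤ b) (hQ : ∀ 𝒯 ∈ forest K L, marked ζ δ 𝒯 ⊆ Q)
    {𝒯 𝒯' : Finset (Elem M)} {N : ℕ} (h : GreedyRun K L b ζ δ 𝒯 𝒯' N) (h𝒯 : 𝒯 ∈ forest K L)
    {I : Finset (Elem M)} (hI : IsInterior I 𝒯) : N ≤ (Q \ I).card := by
  induction h generalizing I with
  | exit => exact Nat.zero_le _
  | step 𝒯 𝒯₁ 𝒯' N hs _ ih =>
    have h𝒯₁ := hs.2.1.1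
    obtain ⟨I₁, hI₁⟩ := h𝒯₁.1.exists_isInterior
    exact (Nat.add_le_add_left (ih h𝒯₁ hI₁) _).trans (hs.card_add_le hb hQ h𝒯 hI hI₁)

theorem exists_greedyRun (hd : 0 < d) (hA : IsAdmissible K L) (hb : 1 ≤ b)
    (hQ : ∀ 𝒯 ∈ forest K L, marked ζ δ 𝒯 ⊆ Q) {𝒯 : Finset (Elem M)} (h𝒯 : 𝒯 ∈ forest K L) :
    ∃ 𝒯' N, GreedyRun K L b ζ δ 𝒯 𝒯' N := by
  obtain ⟨I, hI⟩ := h𝒯.1.exists_isInterior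
  induction hn : (Q \ I).card using Nat.strong_induction_on generalizing 𝒯 I with
  | _ n ih =>
    by_cases hm : marked ζ δ 𝒯 = ∅
    · exact ⟨𝒯, 0, .exit 𝒯 hm⟩
    · obtain ⟨𝒯₁, h₁⟩ := exists_isREFINE hd hA b h𝒯.1 (marked ζ δ 𝒯)
      have hs : GreedyStep K L b ζ δ 𝒯 𝒯₁ := ⟨hm, h₁⟩
      obtain ⟨I₁, hI₁⟩ := h₁.1.1.1.exists_isInterior
      have hle := hs.card_add_le hb hQ h𝒯 hI hI₁
      have hpos := Finset.card_pos.2 (Finset.nonempty_iff_ne_empty.2 hm)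
      obtain ⟨𝒯', N, hrun⟩ := ih _ (by omega) h₁.1.1 I₁ hI₁ rfl
      exact ⟨𝒯', _, .step 𝒯 𝒯₁ 𝒯' N hs hrun⟩

/-- Each pass marks at least one element, so the natural number `(Q \ I).card` strictly decreases.
-/
theorem not_exists_infinite_greedyRun (hb : 1 ≤ b)
    (hQ : ∀ 𝒯 ∈ forest K L, marked ζ δ 𝒯 ⊆ Q) {𝒯 : Finset (Elem M)} (h𝒯 : 𝒯 ∈ forest K L) :
    ¬ ∃ S : ℕ → Finset (Elem M), S 0 = 𝒯 ∧ ∀ k, GreedyStep K L b ζ δ (S k) (S (k + 1)) := by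
  rintro ⟨S, hS0, hS⟩
  have hSf : ∀ k, S k ∈ forest K L := fun k => by
    cases k with
    | zero => rwa [hS0]
    | succ k => exact (hS k).2.1.1
  choose I hI using fun k => (hSf k).1.exists_isInterior
  have hbound : ∀ k, k + (Q \ I k).card ≤ (Q \ I 0).card := fun k => by
    induction k with
    | zero => simp
    | succ k ih =>
      have hle := (hS k).card_add_le hb hQ (hSf k) (hI k) (hI (k + 1))
      have hpos := Finset.card_pos.2 (Finset.nonempty_iff_ne_empty.2 (hS k).1)
      omega
  have := hbound ((Q \ I 0).card + 1)
  omega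

end Run

end

end GreedyBisection

theorem propositionP (d M : ℕ) (hd : 0 < d) (Ω : Affine.Simplex ℝ (E d) d)
    (r : ℝ) (hr : 0 < r) (p : ℝ≥0∞) (hp : 0 < p) (C₀ : ℝ) (hC₀ : 0 < C₀) :
    ∃ C : ℝ, 0 < C ∧
      ∀ (K : PolyhedralSurface d M Ω) (L : Labeling d M), IsAdmissible K L →
      ∀ (b : ℕ), 1 ≤ b →
      ∀ (g : Fin M → refRegion Ω → ℝ)
        -- local error estimators `ζ_𝒯(g, T)`, local quantities `|gⁱ|_T`, and `|g|_Ω`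
        (ζ : Finset (Elem M) → (Fin M → refRegion Ω → ℝ) → Elem M → ℝ≥0∞)
        (locNorm : (refRegion Ω → ℝ) → Elem M → ℝ≥0∞)
        (totNorm : (Fin M → refRegion Ω → ℝ) → ℝ≥0∞),
      (∀ 𝒯 ∈ forest K L, ∀ T ∈ 𝒯,
        ζ 𝒯 g T ≤ ENNReal.ofReal (C₀ * meshSize Ω L T ^ r) * locNorm (g T.1) T) →
      (∀ 𝒯 ∈ forest K L, lpAccum p 𝒯 (fun T => locNorm (g T.1) T) ≤ totNorm g) →
      totNorm g < ∞ →
      ∀ 𝒯 ∈ forest K L, ∀ δ : ℝ, 0 < δ →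
        -- `GREEDY(g, 𝒯, δ)` terminates: it reaches its exit, and it has no infinite run
        (∃ 𝒯' N, GreedyRun K L b (fun 𝒰 => ζ 𝒰 g) δ 𝒯 𝒯' N) ∧
        (¬ ∃ S : ℕ → Finset (Elem M), S 0 = 𝒯 ∧
          ∀ k, GreedyStep K L b (fun 𝒰 => ζ 𝒰 g) δ (S k) (S (k + 1))) ∧
        -- the total number `N` of marked elements
        (∀ 𝒯' N, GreedyRun K L b (fun 𝒰 => ζ 𝒰 g) δ 𝒯 𝒯' N →
          (N : ℝ) ≤ C * (totNorm g).toReal ^ greedyExponent d r p *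
            δ ^ (-greedyExponent d r p)) := by
  refine ⟨greedyConstant M Ω r p C₀, greedyConstant_pos hd M Ω hr hp hC₀, ?_⟩
  intro K L hA b hb g ζ locNorm totNorm hζ hloc htot 𝒯 h𝒯 δ hδ
  set a : Elem M → ℝ≥0∞ := fun T => locNorm (g T.1) T with ha
  have hcard := card_le_of_large hd hA hr hp hC₀ htot hloc hδ
  -- The bound holds for every finite set of large nodes, with a constant independent of the set;
  -- hence there are only finitely many of them.
  have hfin : {T : Elem M | ENNReal.ofReal δ <
      ENNReal.ofReal (C₀ * meshSize Ω L T ^ r) * a T}.Finite := by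
    by_contra hinf
    obtain ⟨n, hn⟩ := exists_nat_gt (greedyConstant M Ω r p C₀ *
      (totNorm g).toReal ^ greedyExponent d r p * δ ^ (-greedyExponent d r p))
    obtain ⟨F, hF, hFn⟩ := Set.Infinite.exists_subset_card_eq hinf n
    have := hcard F fun T hT => hF hT
    rw [hFn] at this
    exact absurd hn (not_lt.2 this)
  have hQ : ∀ 𝒯 ∈ forest K L, marked (fun 𝒰 => ζ 𝒰 g) δ 𝒯 ⊆ hfin.toFinset := by
    intro 𝒯 h𝒯 T hT
    obtain ⟨hT𝒯, hTδ⟩ := Finset.mem_filter.1 hT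
    exact hfin.mem_toFinset.2 (hTδ.trans_le (hζ 𝒯 h𝒯 T hT𝒯))
  refine ⟨exists_greedyRun hd hA hb hQ h𝒯, not_exists_infinite_greedyRun hb hQ h𝒯,
    fun 𝒯' N hrun => ?_⟩
  obtain ⟨I, hI⟩ := h𝒯.1.exists_isInterior
  have hN : N ≤ hfin.toFinset.card :=
    (hrun.le_card hb hQ h𝒯 hI).trans (Finset.card_le_card Finset.sdiff_subset)
  exact (Nat.cast_le.2 hN).trans (hcard _ fun T hT => hfin.mem_toFinset.1 hT)
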